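/- Let $\mathbb{N}=\{1,2,3,\dots\}$. For $p\in[0,1]$, a $p$-random subset $A\subseteq\mathbb{N}$ contains each $n\in\mathbb{N}$ with probability $p$, independently of all other elements, and $A+A=\{a+b: a,b\in A\}$. (1) There is an absolute constant $C>1$ such that, for all $m\in\mathbb{N}$, $\varepsilon>0$ and $p>0$ with $$\frac{C\log_2(1/\varepsilon)}{\sqrt{\varepsilon^3 m}}\le p\le \frac12,$$ a $p$-random subset $A\subseteq\mathbb{N}$ satisfies $$\Pr\big(|\mathbb{N}\setminus(A+A)|\ge m\big)<(1-p)^{m/2-\varepsilon m}.$$ (2) $1/\sqrt m$ is a threshold for the event $|\mathbb{N}\setminus(A+A)|\ge m$: for every sequence $(p_m)$ in $[0,1]$ and $p_m$-random subsets $A_m\subseteq\mathbb{N}$, as $m\to\infty$, $\Pr(|\mathbb{N}\setminus(A_m+A_m)|\ge m)$ tends to $1$ if $p_m\sqrt m\to0$, and tends to $0$ if $p_m\sqrt m\to\infty$. (3) For fixed $\varepsilon$ the range of $p$ in (1) is sharp up to the constant: there is an absolute $c>0$ such that for every $0<\varepsilon<1/2$ there is $m_0$ such that for all $m\ge m_0$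 and all $p\in(0,1]$ with $p\le c/\sqrt m$, a $p$-random subset $A\subseteq\mathbb{N}$ satisfies $\Pr(|\mathbb{N}\setminus(A+A)|\ge m)>(1-p)^{m/2-\varepsilon m}$. (4) The probability in (1) is sharp up to the term $\varepsilon m$ in the exponent: for all integers $m\ge0$ and all $p\in[0,1]$, a $p$-random subset $A\subseteq\mathbb{N}$ satisfies $\Pr(|\mathbb{N}\setminus(A+A)|\ge m)\ge(1-p)^{m/2}$. -/

import Mathlib

open MeasureTheory ProbabilityTheory Filter Topology
open scoped Pointwise unitInterval

/-- The law of a `p`-random subset of the positive integers: every positive integer is included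
with probability `p`, independently of all the others. -/
noncomputable def randomSubsetLaw (p : I) : Measure (Set ℕ+) :=
  setBernoulli Set.univ p

/-- The probability that the sumset `A + A` of a `p`-random set `A` of positive integers misses
at least `m` positive integers (possibly infinitely many, hence `encard`). -/
noncomputable def missingProb (p : I) (m : ℕ) : ℝ :=
  (randomSubsetLaw p).real {A : Set ℕ+ | (m : ℕ∞) ≤ ((A + A)ᶜ).encard}

/-! If `A` avoids `[1, m/2]`, then all of `[1, m]` is missing; this gives the lower bound, and the
upper bound says that nothing else is much likelier. Truncation to `[1, M]` and continuity of
measure (`missingProb_le_of_forall`) reduce the upper bounds to finite random sets.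

Beyond `40 * m`: a set `T` of at most `1/p` elements is missing only if the random set is
independent in the graph joining `x ≠ y` when `x + y ∈ T`. `bernP_independent_le` bounds this
probability by a product over `T`. Markov's inequality for the number of missing `r`-subsets, `r ≈
1/p`, then makes `ε m / 4` missing elements negligible (`bernP_card_missing_Ioc_le`). The case `r =
1` shows that `m` missing elements are unlikely above the threshold.

Up to `40 * m`: either `A` has fewer than `k` elements in `[1, m/2]`, which costs about
`(1-p)^(m/2)`, or it contains a `k`-set `F` there. In the second case, reveal greedily those `y` for
which `y + F` meets the remaining candidates for missing elements in many points. Each such `y` in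
`A` destroys many candidates, so almost all revealed `y` must be absent; double counting shows that
about `m/2` of them are revealed before the process stops (`bernP_uncovered_le`,
`bernP_superset_missing_le`). The union bound over `F` is affordable because `k` is small.

Below the threshold, `A` typically has fewer than `√m` elements in `[1, 2m]`, so its sumset misses
`m` elements of that interval (`one_sub_pow_le_missingProb`). -/

/-! ### Calculus of `p`-random subsets of a finite set. -/

section FiniteBernoulli

open Finset

variable {α : Type*} [DecidableEq α]

/-- The expectation of `f S` for a `p`-random subset `S` of the finite set `V`. -/
noncomputable def bernE (p : ℝ) (V : Finset α) (f : Finset α → ℝ) : ℝ :=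
  ∑ S ∈ V.powerset, p ^ #S * (1 - p) ^ #(V \ S) * f S

open Classical in
/-- The probability of `Q S` for a `p`-random subset `S` of the finite set `V`. -/
noncomputable def bernP (p : ℝ) (V : Finset α) (Q : Finset α → Prop) : ℝ :=
  bernE p V fun S => if Q S then 1 else 0

variable {p : ℝ} {V W : Finset α} {f g : Finset α → ℝ} {P Q : Finset α → Prop}

lemma bernE_empty : bernE p (∅ : Finset α) f = f ∅ := by simp [bernE]

lemma bernE_insert {y : α} (hy : y ∉ V) :
    bernE p (insert y V) f = (1 - p) * bernE p V f + p * bernE p V fun S => f (insert y S) := by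
  unfold bernE
  rw [sum_powerset_insert hy, mul_sum, mul_sum]
  congr 1 <;> refine sum_congr rfl fun S hS => ?_
  · have hyS : y ∉ S := fun h => hy (mem_powerset.1 hS h)
    rw [insert_sdiff_of_notMem _ hyS, card_insert_of_notMem (by simp [hy])]
    ring
  · have hyS : y ∉ S := fun h => hy (mem_powerset.1 hS h)
    rw [card_insert_of_notMem hyS, insert_sdiff_insert, sdiff_insert_of_notMem hy]
    ring

lemma bernE_congr (h : ∀ S ⊆ V, f S = g S) : bernE p V f = bernE p V g :=
  sum_congr rfl fun S hS => by rw [h S (mem_powerset.1 hS)]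

lemma bernE_mono (h0 : 0 ≤ p) (h1 : p ≤ 1) (h : ∀ S ⊆ V, f S ≤ g S) :
    bernE p V f ≤ bernE p V g := by
  have := sub_nonneg.2 h1
  exact sum_le_sum fun S hS => mul_le_mul_of_nonneg_left (h S (mem_powerset.1 hS)) (by positivity)

lemma bernE_const (c : ℝ) : bernE p V (fun _ => c) = c := by
  induction V using Finset.induction_on with
  | empty => simp [bernE_empty]
  | insert y V hy ih => rw [bernE_insert hy, ih]; ring

lemma bernE_const_mul (c : ℝ) : bernE p V (fun S => c * f S) = c * bernE p V f := by
  unfold bernE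
  rw [mul_sum]
  exact sum_congr rfl fun S _ => by ring

lemma bernE_add : bernE p V (fun S => f S + g S) = bernE p V f + bernE p V g := by
  simp only [bernE, mul_add, sum_add_distrib]

lemma bernE_sum {ι : Type*} (s : Finset ι) (F : ι → Finset α → ℝ) :
    bernE p V (fun S => ∑ i ∈ s, F i S) = ∑ i ∈ s, bernE p V (F i) := by
  simp only [bernE, mul_sum]
  exact sum_comm

/-- Disjoint parts of a random set are independent. -/
lemma bernE_union (h : Disjoint V W) :
    bernE p (V ∪ W) f = bernE p V fun S => bernE p W fun R => f (S ∪ R) := by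
  induction V using Finset.induction_on generalizing f with
  | empty => simp [bernE_empty]
  | insert y V hy ih =>
    rw [disjoint_insert_left] at h
    rw [insert_union, bernE_insert (by simp [hy, h.1]), ih h.2, ih h.2, bernE_insert hy]
    simp only [insert_union]

lemma bernE_restrict (hW : W ⊆ V) (h : ∀ S ⊆ V, f S = f (S ∩ W)) :
    bernE p V f = bernE p W f := by
  rw [← union_sdiff_of_subset hW, bernE_union disjoint_sdiff]
  refine bernE_congr fun S hS => ?_
  rw [← bernE_const (p := p) (V := V \ W) (f S)]
  refine bernE_congr fun R hR => ?_
  rw [h (S ∪ R) (union_subset (hS.trans hW) (hR.trans sdiff_subset)), union_inter_distrib_right,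
    inter_eq_left.2 hS, disjoint_iff_inter_eq_empty.1 (sdiff_disjoint.mono_left hR), union_empty]

lemma bernE_pow_card (x : ℝ) : bernE p V (fun S => x ^ #S) = (1 - p + p * x) ^ #V := by
  induction V using Finset.induction_on with
  | empty => simp [bernE_empty]
  | insert y V hy ih =>
    rw [bernE_insert hy, card_insert_of_notMem hy, pow_succ, ← ih]
    have : bernE p V (fun S => x ^ #(insert y S)) = x * bernE p V (fun S => x ^ #S) := by
      rw [← bernE_const_mul]
      refine bernE_congr fun S hS => ?_
      rw [card_insert_of_notMem fun h => hy (hS h), pow_succ']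
    rw [this]; ring

lemma bernP_insert {y : α} (hy : y ∉ V) :
    bernP p (insert y V) Q = (1 - p) * bernP p V Q + p * bernP p V fun S => Q (insert y S) :=
  bernE_insert hy

lemma bernP_congr (h : ∀ S ⊆ V, (P S ↔ Q S)) : bernP p V P = bernP p V Q :=
  bernE_congr fun S hS => by classical exact if_congr (h S hS) rfl rfl

lemma bernP_mono (h0 : 0 ≤ p) (h1 : p ≤ 1) (h : ∀ S ⊆ V, P S → Q S) :
    bernP p V P ≤ bernP p V Q :=
  bernE_mono h0 h1 fun S hS => by
    have := h S hS
    by_cases hP : P S <;> by_cases hQ : Q S <;> simp_all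

lemma bernP_le_one (h0 : 0 ≤ p) (h1 : p ≤ 1) : bernP p V Q ≤ 1 := by
  rw [← bernE_const (p := p) (V := V) (1 : ℝ)]
  exact bernE_mono h0 h1 fun S _ => by split_ifs <;> simp

lemma bernP_nonneg (h0 : 0 ≤ p) (h1 : p ≤ 1) : 0 ≤ bernP p V Q := by
  rw [← bernE_const (p := p) (V := V) (0 : ℝ)]
  exact bernE_mono h0 h1 fun S _ => by split_ifs <;> simp

lemma bernP_add_not : bernP p V Q + bernP p V (fun S => ¬ Q S) = 1 := by
  rw [← bernE_const (p := p) (V := V) (1 : ℝ)]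
  unfold bernP
  rw [← bernE_add]
  exact bernE_congr fun S _ => by by_cases h : Q S <;> simp [h]

lemma bernP_eq_zero (h : ∀ S ⊆ V, ¬ Q S) : bernP p V Q = 0 := by
  rw [← bernE_const (p := p) (V := V) (0 : ℝ)]
  exact bernE_congr fun S hS => by simp [h S hS]

/-- Markov's inequality. -/
lemma bernP_le_bernE (h0 : 0 ≤ p) (h1 : p ≤ 1) (hf : ∀ S ⊆ V, 0 ≤ f S)
    (h : ∀ S ⊆ V, Q S → 1 ≤ f S) : bernP p V Q ≤ bernE p V f :=
  bernE_mono h0 h1 fun S hS => by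
    split_ifs with hQ
    exacts [h S hS hQ, hf S hS]

lemma bernP_or_le (h0 : 0 ≤ p) (h1 : p ≤ 1) :
    bernP p V (fun S => P S ∨ Q S) ≤ bernP p V P + bernP p V Q := by
  unfold bernP
  rw [← bernE_add]
  exact bernE_mono h0 h1 fun S _ => by
    by_cases hP : P S <;> by_cases hQ : Q S <;> simp [hP, hQ]

lemma bernP_exists_le {ι : Type*} (h0 : 0 ≤ p) (h1 : p ≤ 1) (s : Finset ι)
    (R : ι → Finset α → Prop) :
    bernP p V (fun S => ∃ i ∈ s, R i S) ≤ ∑ i ∈ s, bernP p V (R i) := by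
  classical
  unfold bernP
  rw [← bernE_sum]
  refine bernE_mono h0 h1 fun S _ => ?_
  split_ifs with h
  · obtain ⟨i, hi, hR⟩ := h
    calc (1 : ℝ) = if R i S then 1 else 0 := by simp [hR]
      _ ≤ _ := single_le_sum (f := fun i => if R i S then (1 : ℝ) else 0)
        (fun j _ => by split_ifs <;> simp) hi
  · exact sum_nonneg fun i _ => by split_ifs <;> simp

lemma bernP_restrict (hW : W ⊆ V) (h : ∀ S ⊆ V, (Q S ↔ Q (S ∩ W))) :
    bernP p V Q = bernP p W Q :=
  bernE_restrict hW fun S hS => by classical exact if_congr (h S hS) rfl rfl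

/-- By independence, conditioning on `F ⊆ S` leaves `S \ F` a `p`-random subset of `V \ F`. -/
lemma bernP_superset_and {F : Finset α} (hF : F ⊆ V) :
    bernP p V (fun S => F ⊆ S ∧ Q S) = p ^ #F * bernP p (V \ F) fun S => Q (S ∪ F) := by
  classical
  unfold bernP
  nth_rw 1 [← sdiff_union_of_subset hF]
  rw [bernE_union sdiff_disjoint, ← bernE_const_mul]
  refine bernE_congr fun S hS => ?_
  unfold bernE
  rw [sum_eq_single_of_mem F (mem_powerset_self F)]
  · simp
  · intro R hR hRF
    beta_reduce
    rw [if_neg, mul_zero]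
    rintro ⟨h, -⟩
    refine hRF (subset_antisymm (mem_powerset.1 hR) fun x hx => ?_)
    rcases mem_union.1 (h hx) with h' | h'
    · exact absurd hx (mem_sdiff.1 (hS h')).2
    · exact h'

lemma bernP_disjoint_and {B : Finset α} (hB : B ⊆ V) :
    bernP p V (fun S => Disjoint S B ∧ Q S) = (1 - p) ^ #B * bernP p (V \ B) Q := by
  classical
  unfold bernP
  nth_rw 1 [← sdiff_union_of_subset hB]
  rw [bernE_union sdiff_disjoint, ← bernE_const_mul]
  refine bernE_congr fun S hS => ?_
  unfold bernE
  rw [sum_eq_single_of_mem ∅ (empty_mem_powerset B)]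
  · have : Disjoint S B := sdiff_disjoint.mono_left hS
    simp [this]
  · intro R hR hRB
    beta_reduce
    rw [if_neg, mul_zero]
    rintro ⟨h, -⟩
    exact hRB (disjoint_self_iff_empty R |>.1
      ((disjoint_union_left.1 h).2.mono_right (mem_powerset.1 hR)))

lemma bernP_card_ge (h0 : 0 ≤ p) (h1 : p ≤ 1) (k : ℕ) :
    bernP p V (fun S => k ≤ #S) ≤ (#V).choose k * p ^ k := by
  calc bernP p V (fun S => k ≤ #S)
      ≤ bernP p V (fun S => ∃ F ∈ V.powersetCard k, F ⊆ S ∧ True) := by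
        refine bernP_mono h0 h1 fun S hS hk => ?_
        obtain ⟨F, hF, hFk⟩ := exists_subset_card_eq hk
        exact ⟨F, mem_powersetCard.2 ⟨hF.trans hS, hFk⟩, hF, trivial⟩
    _ ≤ ∑ F ∈ V.powersetCard k, bernP p V (fun S => F ⊆ S ∧ True) :=
        bernP_exists_le h0 h1 _ _
    _ ≤ ∑ F ∈ V.powersetCard k, p ^ k := by
        refine sum_le_sum fun F hF => ?_
        rw [mem_powersetCard] at hF
        rw [bernP_superset_and hF.1, hF.2]
        exact mul_le_of_le_one_right (by positivity) (bernP_le_one h0 h1)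
    _ = _ := by simp

/-- Lower tail bound. -/
lemma bernP_card_lt (h0 : 0 ≤ p) (h1 : p ≤ 1 / 2) (k : ℕ) {x : ℝ} (hx : 0 < x) (hx1 : x ≤ 1) :
    bernP p V (fun S => #S < k) ≤ (1 - p) ^ #V * Real.exp (2 * p * x * #V) * (x⁻¹) ^ k := by
  have h1' : p ≤ 1 := by linarith
  calc bernP p V (fun S => #S < k)
      ≤ bernE p V (fun S => (x⁻¹) ^ k * x ^ #S) := by
        refine bernP_le_bernE h0 h1' (fun S _ => by positivity) fun S _ hS => ?_
        rw [inv_pow, ← div_eq_inv_mul, one_le_div (by positivity)]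
        exact pow_le_pow_of_le_one hx.le hx1 hS.le
    _ = (1 - p + p * x) ^ #V * (x⁻¹) ^ k := by
        rw [bernE_const_mul, bernE_pow_card]; ring
    -- The factor `1 - p` is kept exactly, since it is the main term of the final bound; `p ≤ 1/2`
    -- pays for the division of `p * x` by it.
    _ ≤ ((1 - p) * Real.exp (2 * p * x)) ^ #V * (x⁻¹) ^ k := by
        have h4 : 0 ≤ 1 - p + p * x := by nlinarith [mul_nonneg h0 hx.le]
        gcongr
        · have h2 := Real.add_one_le_exp (2 * p * x)
          have h3 : (1 - p) * (2 * p * x + 1) ≤ (1 - p) * Real.exp (2 * p * x) :=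
            mul_le_mul_of_nonneg_left h2 (by linarith)
          nlinarith [mul_nonneg (mul_nonneg h0 hx.le) (by linarith : (0:ℝ) ≤ 1 - 2 * p)]
    _ = _ := by rw [mul_pow, ← Real.exp_nat_mul]; ring_nf

end FiniteBernoulli

/-! ### From the infinite product measure to finite random sets. -/

section Trace

open Finset

open Classical in
/-- The part of `A` up to `M`, as a finite set of natural numbers. -/
noncomputable def initialPart (A : Set ℕ+) (M : ℕ) : Finset ℕ :=
  (Icc 1 M).filter fun n => ∃ a ∈ A, (a : ℕ) = n

lemma initialPart_subset (A : Set ℕ+) (M : ℕ) : initialPart A M ⊆ Icc 1 M := by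
  classical exact fun n hn => (mem_filter.1 hn).1

lemma coe_mem_initialPart {A : Set ℕ+} {M : ℕ} {a : ℕ+} :
    (a : ℕ) ∈ initialPart A M ↔ (a : ℕ) ≤ M ∧ a ∈ A := by
  simp [initialPart, Nat.one_le_iff_ne_zero]

/-- The positive integers up to `M`. -/
def initialPNat (M : ℕ) : Finset ℕ+ := (Icc 1 M).subtype (0 < ·)

lemma mem_initialPNat {M : ℕ} {i : ℕ+} : i ∈ initialPNat M ↔ (i : ℕ) ≤ M := by
  refine mem_subtype.trans ?_
  have := i.pos
  simp only [mem_Icc]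
  exact ⟨fun h => h.2, fun h => ⟨this, h⟩⟩

/-- Prescribing the trace on `[1, M]` is a cylinder event, whose measure under the product law is a
finite product. -/
lemma preimage_initialPart_eq {M : ℕ} {S : Finset ℕ} (hS : S ⊆ Icc 1 M) :
    (fun f : ℕ+ → Prop => {i | f i}) ⁻¹' {A : Set ℕ+ | initialPart A M = S} =
      Set.pi (↑(initialPNat M)) fun i : ℕ+ => {((i : ℕ) ∈ S : Prop)} := by
  ext f
  simp only [Set.mem_preimage, Set.mem_ofPred_eq, Set.mem_pi, Finset.mem_coe, mem_initialPNat,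
    Set.mem_singleton_iff]
  constructor
  · rintro rfl i hi
    simp [coe_mem_initialPart, hi]
  · intro hf
    ext n
    constructor
    · intro hn
      have h1 := mem_Icc.1 (initialPart_subset _ _ hn)
      have h2 := coe_mem_initialPart (a := ⟨n, h1.1⟩).1 hn
      have h4 : f ⟨n, h1.1⟩ := h2.2
      rw [hf ⟨n, h1.1⟩ h1.2] at h4
      exact h4
    · intro hn
      have h1 := mem_Icc.1 (hS hn)
      refine coe_mem_initialPart (a := ⟨n, h1.1⟩).2 ⟨h1.2, ?_⟩
      change f ⟨n, h1.1⟩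
      rw [hf ⟨n, h1.1⟩ h1.2]
      exact hn

lemma measurableSet_initialPart_eq {M : ℕ} {S : Finset ℕ} (hS : S ⊆ Icc 1 M) :
    MeasurableSet {A : Set ℕ+ | initialPart A M = S} := by
  rw [← MeasurableEquiv.setOfPred.measurableSet_preimage]
  have h := preimage_initialPart_eq hS
  rw [show ⇑MeasurableEquiv.setOfPred = fun f : ℕ+ → Prop => {i | f i} from rfl, h]
  exact MeasurableSet.pi (initialPNat M).countable_toSet fun _ _ => measurableSet_singleton _

lemma randomSubsetLaw_initialPart_eq (p : I) {M : ℕ} {S : Finset ℕ} (hS : S ⊆ Icc 1 M) :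
    (randomSubsetLaw p).real {A : Set ℕ+ | initialPart A M = S} =
      (p : ℝ) ^ #S * (1 - (p : ℝ)) ^ #(Icc 1 M \ S) := by
  rw [randomSubsetLaw, measureReal_def, setBernoulli_apply', preimage_initialPart_eq hS,
    Measure.infinitePi_pi _ fun _ _ => measurableSet_singleton _, ENNReal.toReal_prod]
  have h : ∀ i : ℕ+, ((unitInterval.toNNReal p • Measure.dirac (i ∈ (Set.univ : Set ℕ+)) +
      unitInterval.toNNReal (σ p) • Measure.dirac False) {((i : ℕ) ∈ S : Prop)}).toReal =
      if (i : ℕ) ∈ S then (p : ℝ) else 1 - (p : ℝ) := by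
    intro i
    by_cases hi : (i : ℕ) ∈ S <;> simp [hi]
  rw [prod_congr rfl fun i _ => h i]
  have h2 : ∏ i ∈ initialPNat M, (if (i : ℕ) ∈ S then (p : ℝ) else 1 - (p : ℝ)) =
      ∏ n ∈ Icc 1 M, if n ∈ S then (p : ℝ) else 1 - (p : ℝ) :=
    prod_subtype_of_mem (fun n : ℕ => if n ∈ S then (p : ℝ) else 1 - (p : ℝ))
      (fun n hn => (mem_Icc.1 hn).1)
  rw [h2, prod_ite, prod_const, prod_const, filter_mem_eq_inter, inter_eq_right.2 hS,
    filter_notMem_eq_sdiff]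

instance (p : I) : IsProbabilityMeasure (randomSubsetLaw p) := by
  unfold randomSubsetLaw; infer_instance

/-- Events that depend only on `A ∩ [1, M]` have the corresponding finite probability. -/
lemma randomSubsetLaw_initialPart (p : I) (M : ℕ) (Q : Finset ℕ → Prop) :
    (randomSubsetLaw p).real {A : Set ℕ+ | Q (initialPart A M)} = bernP (p : ℝ) (Icc 1 M) Q := by
  classical
  have h : {A : Set ℕ+ | Q (initialPart A M)} =
      ⋃ S ∈ (Icc 1 M).powerset.filter Q, {A : Set ℕ+ | initialPart A M = S} := by
    ext A
    simp [initialPart_subset]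
  rw [h, measureReal_biUnion_finset, bernP, bernE, sum_filter]
  · refine sum_congr rfl fun S hS => ?_
    split_ifs with hQ
    · rw [randomSubsetLaw_initialPart_eq p (mem_powerset.1 hS), mul_one]
    · rw [mul_zero]
  · intro S _ R _ hSR
    refine Set.disjoint_left.2 fun A h1 h2 => hSR ?_
    exact h1.symm.trans h2
  · intro S hS
    exact measurableSet_initialPart_eq (mem_powerset.1 (mem_filter.1 hS).1)

end Trace

/-! ### Missing elements and truncation. -/

section Missing

open Finset

/-- The elements of `U` that are not sums of two elements of `S`. -/
def missing (U S : Finset ℕ) : Finset ℕ := U \ (S + S)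

lemma missing_subset (U S : Finset ℕ) : missing U S ⊆ U := sdiff_subset

lemma mem_missing {U S : Finset ℕ} {n : ℕ} :
    n ∈ missing U S ↔ n ∈ U ∧ ∀ x ∈ S, ∀ y ∈ S, x + y ≠ n := by
  simp [missing, Finset.mem_add]

lemma coe_mem_missing {A : Set ℕ+} {M : ℕ} {n : ℕ+} :
    (n : ℕ) ∈ missing (Icc 1 M) (initialPart A M) ↔ (n : ℕ) ≤ M ∧ n ∈ (A + A)ᶜ := by
  rw [mem_missing, mem_Icc, Set.mem_compl_iff, Set.mem_add]
  constructor
  · rintro ⟨⟨-, hn⟩, h⟩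
    refine ⟨hn, ?_⟩
    rintro ⟨a, ha, b, hb, hab⟩
    have hab' : (a : ℕ) + b = n := by rw [← hab]; rfl
    exact h a (coe_mem_initialPart.2 ⟨by omega, ha⟩) b (coe_mem_initialPart.2 ⟨by omega, hb⟩) hab'
  · rintro ⟨hn, h⟩
    refine ⟨⟨n.pos, hn⟩, fun x hx y hy hxy => h ?_⟩
    have hx1 := (mem_Icc.1 (initialPart_subset _ _ hx)).1
    have hy1 := (mem_Icc.1 (initialPart_subset _ _ hy)).1
    exact ⟨⟨x, hx1⟩, (coe_mem_initialPart (a := ⟨x, hx1⟩).1 hx).2, ⟨y, hy1⟩,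
      (coe_mem_initialPart (a := ⟨y, hy1⟩).1 hy).2, PNat.eq hxy⟩

lemma missing_initialPart (A : Set ℕ+) (M : ℕ) :
    (missing (Icc 1 M) (initialPart A M) : Set ℕ) =
      (fun n : ℕ+ => (n : ℕ)) '' ((A + A)ᶜ ∩ {n | (n : ℕ) ≤ M}) := by
  ext n
  simp only [Finset.mem_coe, Set.mem_image, Set.mem_inter_iff, Set.mem_ofPred_eq]
  constructor
  · intro h
    have h1 := (mem_Icc.1 (missing_subset _ _ h)).1
    have h2 := coe_mem_missing (n := ⟨n, h1⟩).1 h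
    exact ⟨⟨n, h1⟩, ⟨h2.2, h2.1⟩, rfl⟩
  · rintro ⟨a, ⟨h1, h2⟩, rfl⟩
    exact coe_mem_missing.2 ⟨h2, h1⟩

lemma encard_missing_initialPart (A : Set ℕ+) (M : ℕ) :
    ((#(missing (Icc 1 M) (initialPart A M)) : ℕ) : ℕ∞) =
      ((A + A)ᶜ ∩ {n : ℕ+ | (n : ℕ) ≤ M}).encard := by
  rw [← Set.encard_coe_eq_coe_finsetCard, missing_initialPart,
    Function.Injective.encard_image PNat.coe_injective]

lemma bernP_missing_le_missingProb (p : I) (m M : ℕ) :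
    bernP (p : ℝ) (Icc 1 M) (fun S => m ≤ #(missing (Icc 1 M) S)) ≤ missingProb p m := by
  rw [← randomSubsetLaw_initialPart, missingProb]
  refine measureReal_mono fun A hA => ?_
  have hA' : m ≤ #(missing (Icc 1 M) (initialPart A M)) := hA
  calc (m : ℕ∞) ≤ (#(missing (Icc 1 M) (initialPart A M)) : ℕ) := by exact_mod_cast hA'
    _ = _ := encard_missing_initialPart A M
    _ ≤ _ := Set.encard_le_encard Set.inter_subset_left

/-- Any `m` missing elements lie below some `M`, so the event is contained in an increasing union of
truncated events, and continuity from below applies. -/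
lemma missingProb_le_of_forall (p : I) (m M₀ : ℕ) (b : ℝ)
    (h : ∀ M ≥ M₀, bernP (p : ℝ) (Icc 1 M) (fun S => m ≤ #(missing (Icc 1 M) S)) ≤ b) :
    missingProb p m ≤ b := by
  let E : ℕ → Set (Set ℕ+) := fun M => {A | m ≤ #(missing (Icc 1 M) (initialPart A M))}
  have hmono : Monotone E := by
    intro M N hMN A hA
    have hA' : m ≤ #(missing (Icc 1 M) (initialPart A M)) := hA
    have : ((m : ℕ) : ℕ∞) ≤ (#(missing (Icc 1 N) (initialPart A N)) : ℕ) := by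
      calc (m : ℕ∞) ≤ (#(missing (Icc 1 M) (initialPart A M)) : ℕ) := by exact_mod_cast hA'
        _ ≤ _ := by
          rw [encard_missing_initialPart, encard_missing_initialPart]
          exact Set.encard_le_encard
            (Set.inter_subset_inter_right _ fun n (hn : (n : ℕ) ≤ M) => hn.trans hMN)
    exact_mod_cast this
  have hU : {A : Set ℕ+ | (m : ℕ∞) ≤ ((A + A)ᶜ).encard} ⊆ ⋃ M, E M := by
    intro A hA
    obtain ⟨t, ht, htm⟩ := Set.exists_subset_encard_eq (show (m : ℕ∞) ≤ ((A + A)ᶜ).encard from hA)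
    have hfin : t.Finite := Set.finite_of_encard_eq_coe htm
    obtain ⟨M, hM⟩ := (hfin.image fun n : ℕ+ => (n : ℕ)).bddAbove
    refine Set.mem_iUnion.2 ⟨M, ?_⟩
    have : ((m : ℕ) : ℕ∞) ≤ (#(missing (Icc 1 M) (initialPart A M)) : ℕ) := by
      rw [encard_missing_initialPart, ← htm]
      exact Set.encard_le_encard fun n hn => ⟨ht hn, hM ⟨n, hn, rfl⟩⟩
    exact_mod_cast (show m ≤ #(missing (Icc 1 M) (initialPart A M)) by exact_mod_cast this)
  have hlim := tendsto_measure_iUnion_atTop (μ := randomSubsetLaw p) hmono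
  have hlim' := (ENNReal.tendsto_toReal (measure_ne_top (randomSubsetLaw p) _)).comp hlim
  calc missingProb p m ≤ (randomSubsetLaw p).real (⋃ M, E M) := measureReal_mono hU
    _ ≤ b := by
      refine le_of_tendsto hlim' (eventually_atTop.2 ⟨M₀, fun M hM => ?_⟩)
      have := h M hM
      rwa [← randomSubsetLaw_initialPart] at this

end Missing

/-! ### Random independent sets in graphs of bounded degree. -/

section IndependentSets

open Finset

variable {α : Type*} [DecidableEq α] (R : α → α → Prop) [DecidableRel R]

/-- The number of ordered pairs of elements of `V` related by `R`. -/
def pairCount (V : Finset α) : ℕ := ∑ x ∈ V, #{y ∈ V | R x y}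

variable {R}

/-- The factor `2` covers the ordered pairs whose first or whose second entry lies in `U`. -/
lemma pairCount_le_sdiff (hR : ∀ x y, R x y → R y x) {U V : Finset α} (hU : U ⊆ V) :
    pairCount R V ≤ pairCount R (V \ U) + 2 * ∑ u ∈ U, #{y ∈ V | R u y} := by
  have h1 : ∀ x, #{y ∈ V | R x y} ≤ #{y ∈ V \ U | R x y} + #{y ∈ U | R x y} := by
    intro x
    rw [← sdiff_union_of_subset hU, filter_union, sdiff_union_of_subset hU]
    exact card_union_le _ _
  have h2 : ∑ x ∈ V \ U, #{y ∈ U | R x y} ≤ ∑ u ∈ U, #{y ∈ V | R u y} := by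
    calc ∑ x ∈ V \ U, #{y ∈ U | R x y} ≤ ∑ x ∈ V, #{y ∈ U | R x y} :=
          sum_le_sum_of_subset sdiff_subset
      _ = ∑ u ∈ U, #{x ∈ V | R x u} := by
          simp only [card_filter]
          exact sum_comm
      _ ≤ _ := sum_le_sum fun u _ => card_le_card fun x hx => by
          simp only [mem_filter] at hx ⊢
          exact ⟨hx.1, hR _ _ hx.2⟩
  unfold pairCount
  rw [← sum_sdiff hU]
  have h3 := sum_le_sum fun x (_ : x ∈ V \ U) => h1 x
  rw [sum_add_distrib] at h3
  omega

lemma exp_neg_le_one_sub_half {y : ℝ} (h0 : 0 ≤ y) (h1 : y ≤ 1) :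
    Real.exp (-y) ≤ 1 - y / 2 := by
  rw [Real.exp_neg]
  have h := Real.add_one_le_exp y
  rw [inv_le_comm₀ (Real.exp_pos y) (by linarith)]
  refine le_trans ?_ h
  rw [inv_le_comm₀ (by linarith) (by linarith), ← one_div, div_le_iff₀ (by linarith)]
  nlinarith

/-- In a graph of maximum degree at most `1 / p`, the probability that a `p`-random set of vertices
is independent is exponentially small in `p ^ 2` times the number of edges. -/
theorem bernP_independent_le (hR : ∀ x y, R x y → R y x) (hirr : ∀ x, ¬ R x x) {p : ℝ}
    (h0 : 0 ≤ p) (h1 : p ≤ 1) {D : ℕ} (hD : p * D ≤ 1) (V : Finset α)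
    (hdeg : ∀ x ∈ V, #{y ∈ V | R x y} ≤ D) :
    bernP p V (fun S => ∀ x ∈ S, ∀ y ∈ S, ¬ R x y) ≤ Real.exp (-(p ^ 2 / 8 * pairCount R V)) := by
  induction V using Finset.strongInduction with
  | H V ih =>
  rcases V.eq_empty_or_nonempty with rfl | ⟨v, hv⟩
  · simpa [pairCount] using bernP_le_one h0 h1
  set V' := V.erase v with hV'
  have hins : V = insert v V' := (insert_erase hv).symm
  have hvV' : v ∉ V' := notMem_erase v V
  have hsub : V' ⊆ V := erase_subset v V
  have hss : V' ⊂ V := erase_ssubset hv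
  set N := {y ∈ V' | R v y} with hN
  have hNV' : N ⊆ V' := filter_subset _ _
  have hNV : {y ∈ V | R v y} = N := by
    rw [hins, filter_insert, if_neg (hirr v)]
  have hdeg_mono : ∀ {W : Finset α}, W ⊆ V → ∀ x ∈ W, #{y ∈ W | R x y} ≤ D := fun hW x hx =>
    (card_le_card (filter_subset_filter _ hW)).trans (hdeg x (hW hx))
  have hNss : V' \ N ⊂ V := sdiff_subset.trans_ssubset hss
  have ih1 := ih V' hss (hdeg_mono hsub)
  have ih2 := ih (V' \ N) hNss (hdeg_mono hNss.1)
  have hd : #N ≤ D := hNV ▸ hdeg v hv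
  have e1 : pairCount R V ≤ pairCount R V' + 2 * #N := by
    have := pairCount_le_sdiff hR (singleton_subset_iff.2 hv)
    rwa [sum_singleton, sdiff_singleton_eq_erase, hNV] at this
  have e2 : pairCount R V' ≤ pairCount R (V' \ N) + 2 * (#N * D) := by
    refine (pairCount_le_sdiff hR hNV').trans ?_
    gcongr
    refine (sum_le_card_nsmul N _ D fun u hu => ?_).trans (by simp)
    exact hdeg_mono hsub u (hNV' hu)
  have e1' : (pairCount R V : ℝ) ≤ pairCount R V' + 2 * #N := by exact_mod_cast e1
  have e2' : (pairCount R V' : ℝ) ≤ pairCount R (V' \ N) + 2 * (#N * D) := by exact_mod_cast e2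
  have hq : 0 ≤ 1 - p := by linarith
  -- Expose an arbitrary vertex `v`. If it is absent, delete it; if it is present, all its
  -- neighbours `N` must be absent, and `N` is deleted as well.
  have hsplit : bernP p V (fun S => ∀ x ∈ S, ∀ y ∈ S, ¬ R x y) ≤
      (1 - p) * bernP p V' (fun S => ∀ x ∈ S, ∀ y ∈ S, ¬ R x y) +
      p * ((1 - p) ^ #N * bernP p (V' \ N) (fun S => ∀ x ∈ S, ∀ y ∈ S, ¬ R x y)) := by
    conv_lhs => rw [hins]
    rw [bernP_insert hvV', ← bernP_disjoint_and hNV']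
    gcongr
    refine bernP_mono h0 h1 fun S _ hS => ⟨?_, fun x hx y hy =>
      hS x (mem_insert_of_mem hx) y (mem_insert_of_mem hy)⟩
    rw [disjoint_left]
    intro x hx hxN
    exact hS v (mem_insert_self _ _) x (mem_insert_of_mem hx) (mem_filter.1 hxN).2
  set b := p ^ 2 / 8 with hb
  obtain ⟨d, hdd⟩ : ∃ d : ℝ, d = (#N : ℝ) := ⟨_, rfl⟩
  rw [← hdd] at e1' e2'
  have hd0 : 0 ≤ d := hdd ▸ Nat.cast_nonneg _
  have hdD : d ≤ D := by rw [hdd]; exact_mod_cast hd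
  have hu : p * d ≤ 1 := (mul_le_mul_of_nonneg_left hdD h0).trans hD
  have hu0 : 0 ≤ p * d := mul_nonneg h0 hd0
  have f1 : Real.exp (-(b * pairCount R V')) ≤
      Real.exp (-(b * pairCount R V)) * Real.exp (p * (p * d) / 4) := by
    rw [← Real.exp_add, Real.exp_le_exp]
    have := mul_le_mul_of_nonneg_left e1' (by positivity : 0 ≤ b)
    rw [hb] at this ⊢
    linarith
  -- The absence of `N` gains `exp (-p d)`. The edges deleted with `N` lose at most `exp (p d / 4)`,
  -- because `p D ≤ 1`; a gain of `exp (-3 p d / 4)` remains.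
  have f2 : (1 - p) ^ #N * Real.exp (-(b * pairCount R (V' \ N))) ≤
      Real.exp (-(b * pairCount R V)) * (Real.exp (p * (p * d) / 4) *
        Real.exp (-(3 / 4 * (p * d)))) := by
    have g1 : (1 - p) ^ #N ≤ Real.exp (-(p * d)) := by
      rw [show -(p * d) = #N * (-p) by rw [hdd]; ring, Real.exp_nat_mul]
      gcongr
      linarith [Real.add_one_le_exp (-p)]
    refine (mul_le_mul_of_nonneg_right g1 (Real.exp_pos _).le).trans ?_
    rw [← Real.exp_add, ← Real.exp_add, ← Real.exp_add, Real.exp_le_exp]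
    have g2 := mul_le_mul_of_nonneg_left (e1'.trans (add_le_add_left e2' _)) (by positivity : 0 ≤ b)
    have g3 : p * (p * d) * D ≤ p * d := by
      nlinarith
    rw [hb] at g2 ⊢
    linarith
  -- That gain, realised with probability `p`, outweighs the loss `exp (p ^ 2 d / 4)` from the edges
  -- at `v`, since `3/8 > 1/4`.
  have f3 : (1 - p) + p * Real.exp (-(3 / 4 * (p * d))) ≤ Real.exp (-(p * (p * d) / 4)) := by
    have g1 := exp_neg_le_one_sub_half (y := 3 / 4 * (p * d)) (by linarith) (by linarith)
    have g2 := Real.add_one_le_exp (-(p * (p * d) / 4))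
    have g3 := mul_le_mul_of_nonneg_left g1 h0
    have g4 := mul_nonneg h0 hu0
    linarith
  set E := Real.exp (-(b * pairCount R V))
  have hE : 0 < E := Real.exp_pos _
  set X := Real.exp (p * (p * d) / 4) with hX
  have hX0 : 0 < X := Real.exp_pos _
  calc bernP p V (fun S => ∀ x ∈ S, ∀ y ∈ S, ¬ R x y)
      ≤ (1 - p) * Real.exp (-(b * pairCount R V')) +
        p * ((1 - p) ^ #N * Real.exp (-(b * pairCount R (V' \ N)))) := by
        refine hsplit.trans ?_
        gcongr
    _ ≤ (1 - p) * (E * X) + p * (E * (X * Real.exp (-(3 / 4 * (p * d))))) := by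
        gcongr
    _ = E * (X * ((1 - p) + p * Real.exp (-(3 / 4 * (p * d))))) := by ring
    _ ≤ E * (X * Real.exp (-(p * (p * d) / 4))) := by gcongr
    _ = E := by rw [hX, ← Real.exp_add, add_neg_cancel, Real.exp_zero, mul_one]

end IndependentSets

/-! ### The probability that a given set is missing. -/

section MissedSets

open Finset

/-- Counts the ordered representations `t = x + y` with `x ≠ y`, which are the ordered edges
contributed by `t`. -/
lemma card_Icc_two_mul_ne (t : ℕ) :
    2 * ((t - 1) / 2) ≤ #{x ∈ Icc 1 (t - 1) | 2 * x ≠ t} := by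
  rcases Nat.even_or_odd' t with ⟨c, rfl | rfl⟩
  · have : {x ∈ Icc 1 (2 * c - 1) | 2 * x ≠ 2 * c} = (Icc 1 (2 * c - 1)).erase c := by
      ext x; simp only [mem_filter, mem_erase, mem_Icc]; omega
    rw [this]
    have := pred_card_le_card_erase (s := Icc 1 (2 * c - 1)) (a := c)
    rw [Nat.card_Icc] at this
    omega
  · have : {x ∈ Icc 1 (2 * c + 1 - 1) | 2 * x ≠ 2 * c + 1} = Icc 1 (2 * c + 1 - 1) := by
      ext x; simp only [mem_filter, mem_Icc]; omega
    rw [this, Nat.card_Icc]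
    omega

lemma bernP_subset_missing_le {p : ℝ} (h0 : 0 ≤ p) (h1 : p ≤ 1) {M : ℕ} {T : Finset ℕ}
    (hT : T ⊆ Icc 1 M) (hp : p * #T ≤ 1) :
    bernP p (Icc 1 M) (fun S => T ⊆ missing (Icc 1 M) S) ≤
      ∏ t ∈ T, Real.exp (-(p ^ 2 / 4 * ((t - 1) / 2 : ℕ))) := by
  -- If `T` is missing, the random set is independent in this graph. The diagonal is dropped to
  -- avoid loops; degrees are at most `#T`, as `y ↦ x + y` maps neighbours of `x` injectively into
  -- `T`.
  let R : ℕ → ℕ → Prop := fun x y => x ≠ y ∧ x + y ∈ T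
  have hdeg : ∀ x ∈ Icc 1 M, #{y ∈ Icc 1 M | R x y} ≤ #T := fun x _ =>
    card_le_card_of_injOn (x + ·) (fun y hy => (mem_filter.1 hy).2.2)
      (fun a _ b _ hab => Nat.add_left_cancel hab)
  have hcount : ∑ t ∈ T, 2 * ((t - 1) / 2) ≤ pairCount R (Icc 1 M) := by
    have e1 : ∀ x ∈ Icc 1 M, #{t ∈ T | x < t ∧ 2 * x ≠ t} ≤ #{y ∈ Icc 1 M | R x y} := by
      intro x hx
      refine card_le_card_of_injOn (· - x) (fun t ht => ?_) (fun a ha b hb hab => ?_)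
      · obtain ⟨htT, h1, h2⟩ := mem_filter.1 ht
        have := mem_Icc.1 (hT htT)
        have hx1 := mem_Icc.1 hx
        have h3 : t - x ∈ Icc 1 M := mem_Icc.2 (by omega)
        refine mem_filter.2 ⟨h3, ?_, ?_⟩
        · change x ≠ t - x
          omega
        · change x + (t - x) ∈ T
          rwa [show x + (t - x) = t by omega]
      · have ha := (mem_filter.1 ha).2
        have hb := (mem_filter.1 hb).2
        simp only at hab
        omega
    refine le_trans ?_ (sum_le_sum e1)
    simp only [card_filter]
    rw [sum_comm]
    refine sum_le_sum fun t ht => ?_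
    refine (card_Icc_two_mul_ne t).trans ?_
    rw [← card_filter]
    refine card_le_card fun x hx => ?_
    have := mem_Icc.1 (hT ht)
    simp only [mem_filter, mem_Icc] at hx ⊢
    omega
  refine (bernP_mono h0 h1 fun S hS hTS => ?_).trans ((bernP_independent_le (R := R)
    (fun x y h => ⟨h.1.symm, by rw [add_comm]; exact h.2⟩) (fun x h => h.1 rfl) h0 h1 hp (Icc 1 M)
    hdeg).trans ?_)
  · intro x hx y hy hxy
    exact (mem_missing.1 (hTS hxy.2)).2 x hx y hy rfl
  · rw [← Real.exp_sum, Real.exp_le_exp]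
    have : ((∑ t ∈ T, 2 * ((t - 1) / 2) : ℕ) : ℝ) ≤ pairCount R (Icc 1 M) := by
      exact_mod_cast hcount
    rw [sum_neg_distrib, neg_le_neg_iff, ← mul_sum]
    rw [← mul_sum] at this
    push_cast at this ⊢
    nlinarith [mul_le_mul_of_nonneg_left this (by positivity : 0 ≤ p ^ 2 / 8)]

end MissedSets

/-! ### Moment bounds for missing elements. -/

section Moments

open Finset

/-- The elementary symmetric sum is one coefficient of `∏ (1 + y * w i)`, which is at most `exp (y *
∑ w i)`. -/
lemma sum_powersetCard_prod_le {ι : Type*} [DecidableEq ι] (U : Finset ι) {w : ι → ℝ}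
    (hw : ∀ i ∈ U, 0 ≤ w i) (r : ℕ) {y : ℝ} (hy : 0 < y) :
    ∑ T ∈ U.powersetCard r, ∏ i ∈ T, w i ≤ Real.exp (y * ∑ i ∈ U, w i) * (y⁻¹) ^ r := by
  rw [inv_pow, ← div_eq_mul_inv, le_div_iff₀ (by positivity)]
  calc (∑ T ∈ U.powersetCard r, ∏ i ∈ T, w i) * y ^ r
      = ∑ T ∈ U.powersetCard r, ∏ i ∈ T, y * w i := by
        rw [sum_mul]
        refine sum_congr rfl fun T hT => ?_
        rw [prod_mul_distrib, prod_const, (mem_powersetCard.1 hT).2, mul_comm]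
    _ ≤ ∑ T ∈ U.powerset, ∏ i ∈ T, y * w i := by
        refine sum_le_sum_of_subset_of_nonneg
          (fun T hT => mem_powerset.2 (mem_powersetCard.1 hT).1) fun T hT _ => ?_
        exact prod_nonneg fun i hi => mul_nonneg hy.le (hw i (mem_powerset.1 hT hi))
    _ = ∏ i ∈ U, (1 + y * w i) := (prod_one_add U).symm
    _ ≤ ∏ i ∈ U, Real.exp (y * w i) := by
        refine prod_le_prod (fun i hi => ?_) fun i _ => ?_
        · have := mul_nonneg hy.le (hw i hi)
          linarith
        · rw [add_comm]
          exact Real.add_one_le_exp _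
    _ = _ := by rw [← Real.exp_sum, mul_sum]

lemma choose_mul_pow_le {p x : ℝ} (hp : 0 ≤ p) (hx : 0 < x) (L k : ℕ) :
    (L.choose k : ℝ) * p ^ k ≤ Real.exp (p * x * L) * (x⁻¹) ^ k := by
  have h := sum_powersetCard_prod_le (range L) (w := fun _ => p) (fun _ _ => hp) k hx
  have e : ∑ T ∈ (range L).powersetCard k, ∏ i ∈ T, p = (L.choose k : ℝ) * p ^ k := by
    rw [sum_congr rfl fun T hT => by rw [prod_const, (mem_powersetCard.1 hT).2], sum_const,
      card_powersetCard, card_range, nsmul_eq_mul]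
  rw [e, sum_const, card_range, nsmul_eq_mul] at h
  refine h.trans_eq ?_
  ring_nf

/-- Markov's inequality for the number of missing `r`-subsets of `U`, which is at least `s.choose r`
when `s` elements are missing. -/
lemma bernP_card_missing_mul_choose_le {p : ℝ} (h0 : 0 ≤ p) (h1 : p ≤ 1) {M : ℕ} {U : Finset ℕ}
    (hU : U ⊆ Icc 1 M) {r s : ℕ} (hp : p * r ≤ 1) (hrs : r ≤ s) :
    bernP p (Icc 1 M) (fun S => s ≤ #(missing U S)) * s.choose r ≤
      ∑ T ∈ U.powersetCard r, ∏ t ∈ T, Real.exp (-(p ^ 2 / 4 * ((t - 1) / 2 : ℕ))) := by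
  classical
  have hc : 0 < (s.choose r : ℝ) := by exact_mod_cast Nat.choose_pos hrs
  rw [← le_div_iff₀ hc, div_eq_inv_mul]
  calc bernP p (Icc 1 M) (fun S => s ≤ #(missing U S))
      ≤ bernE p (Icc 1 M) (fun S => (s.choose r : ℝ)⁻¹ * ∑ T ∈ U.powersetCard r,
          if T ⊆ missing (Icc 1 M) S then 1 else 0) := by
        refine bernP_le_bernE h0 h1 (fun S _ => ?_) fun S _ hS => ?_
        · refine mul_nonneg (by positivity) (sum_nonneg fun T _ => ?_)
          split_ifs <;> simp
        · rw [← div_eq_inv_mul, one_le_div hc, sum_boole]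
          have e : (missing U S).powersetCard r ⊆
              {T ∈ U.powersetCard r | T ⊆ missing (Icc 1 M) S} := by
            intro T hT
            rw [mem_powersetCard] at hT
            refine mem_filter.2 ⟨mem_powersetCard.2 ⟨hT.1.trans (missing_subset _ _), hT.2⟩, ?_⟩
            exact hT.1.trans (sdiff_subset_sdiff hU subset_rfl)
          have := card_le_card e
          rw [card_powersetCard] at this
          exact_mod_cast (Nat.choose_le_choose r hS).trans this
    _ = (s.choose r : ℝ)⁻¹ * ∑ T ∈ U.powersetCard r,
          bernP p (Icc 1 M) (fun S => T ⊆ missing (Icc 1 M) S) := by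
        rw [bernE_const_mul, bernE_sum]
        refine congrArg _ (sum_congr rfl fun T _ => ?_)
        refine bernE_congr fun S _ => ?_
        congr
    _ ≤ _ := by
        refine mul_le_mul_of_nonneg_left (sum_le_sum fun T hT => ?_) (by positivity)
        rw [mem_powersetCard] at hT
        exact bernP_subset_missing_le h0 h1 (hT.1.trans hU) (by rw [hT.2]; exact hp)

lemma sum_exp_half_le {p : ℝ} (h0 : 0 < p) (h1 : p ≤ 1) {N M : ℕ} (hNM : N ≤ M) :
    ∑ t ∈ Ioc N M, Real.exp (-(p ^ 2 / 4 * ((t - 1) / 2 : ℕ))) ≤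
      Real.exp (-(p ^ 2 * (N - 1) / 8)) * (16 / p ^ 2) := by
  set a := p ^ 2 / 8 with ha
  have ha0 : 0 < a := by positivity
  have ha1 : a ≤ 1 := by rw [ha]; nlinarith
  have hgap : a / 2 ≤ 1 - Real.exp (-a) := by
    linarith [exp_neg_le_one_sub_half ha0.le ha1]
  -- The terms are dominated by a geometric progression of ratio `exp (-a)`; multiplying by `1 - exp
  -- (-a)` telescopes it.
  have key : (∑ t ∈ Ioc N M, Real.exp (-(p ^ 2 / 4 * ((t - 1) / 2 : ℕ)))) * (1 - Real.exp (-a)) ≤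
      Real.exp (-(a * (N - 1))) - Real.exp (-(a * (M - 1))) := by
    induction M, hNM using Nat.le_induction with
    | base => simp
    | succ M hM ih =>
      have hIoc : Ioc N (M + 1) = insert (M + 1) (Ioc N M) := by
        ext x; simp only [mem_Ioc, mem_insert]; omega
      rw [hIoc, sum_insert (by simp), add_mul]
      have e1 : Real.exp (-(p ^ 2 / 4 * ((M + 1 - 1) / 2 : ℕ))) ≤
          Real.exp (-(a * (M - 1))) := by
        rw [Real.exp_le_exp]
        have : (M : ℝ) ≤ 2 * ((M / 2 : ℕ) : ℝ) + 1 := by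
          exact_mod_cast (by omega : M ≤ 2 * (M / 2) + 1)
        rw [Nat.add_sub_cancel, ha]
        nlinarith [mul_le_mul_of_nonneg_left this (by positivity : 0 ≤ p ^ 2 / 8)]
      have e2 : Real.exp (-(a * (M - 1))) * (1 - Real.exp (-a)) =
          Real.exp (-(a * (M - 1))) - Real.exp (-(a * ((M + 1 : ℕ) - 1))) := by
        rw [mul_sub, mul_one, ← Real.exp_add]
        push_cast
        ring_nf
      have e3 := mul_le_mul_of_nonneg_right e1 (by linarith : 0 ≤ 1 - Real.exp (-a))
      linarith
  have hS : 0 ≤ ∑ t ∈ Ioc N M, Real.exp (-(p ^ 2 / 4 * ((t - 1) / 2 : ℕ))) :=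
    sum_nonneg fun _ _ => (Real.exp_pos _).le
  have h3 := mul_le_mul_of_nonneg_left hgap hS
  have h4 := Real.exp_pos (-(a * (M - 1)))
  have h5 : p ^ 2 * (N - 1) / 8 = a * (N - 1) := by rw [ha]; ring
  rw [h5, ← div_le_iff₀ (by positivity)]
  refine le_trans (le_of_eq ?_) ((h3.trans key).trans (sub_le_self _ h4.le))
  rw [ha, div_eq_mul_inv, inv_div]
  ring

/-- It is very unlikely that many elements of `(N, M]` are missing, when `N` is large. -/
lemma bernP_card_missing_Ioc_le {p : ℝ} (h0 : 0 < p) (h1 : p ≤ 1) {N M r s : ℕ} (hNM : N ≤ M)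
    (hr : 1 ≤ r) (hpr : p * r ≤ 1) (hrs : 2 * r ≤ s) (hps : 90 ≤ p ^ 2 * s) :
    bernP p (Icc 1 M) (fun S => s ≤ #(missing (Ioc N M) S)) ≤
      Real.exp (-(p ^ 2 * r * (N - 1) / 8)) := by
  set X := Real.exp (-(p ^ 2 * (N - 1) / 8)) * (16 / p ^ 2) with hX
  have hX0 : 0 < X := by positivity
  have hr0 : (0 : ℝ) < r := by exact_mod_cast hr
  have hs0 : (0 : ℝ) < s := by exact_mod_cast (by omega : 0 < s)
  have hU : Ioc N M ⊆ Icc 1 M := fun x hx => by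
    simp only [mem_Ioc, mem_Icc] at hx ⊢
    omega
  have hA := bernP_card_missing_mul_choose_le h0.le h1 hU hpr (by omega : r ≤ s)
  -- `X` bounds the sum of the weights, so the choice `y = r / X` turns the exponential factor into
  -- `exp r`.
  have hB := sum_powersetCard_prod_le (Ioc N M)
    (w := fun t : ℕ => Real.exp (-(p ^ 2 / 4 * ((t - 1) / 2 : ℕ)))) (fun _ _ => (Real.exp_pos _).le)
    r (div_pos hr0 hX0)
  have hC : Real.exp (r / X * ∑ t ∈ Ioc N M, Real.exp (-(p ^ 2 / 4 * ((t - 1) / 2 : ℕ)))) ≤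
      Real.exp r := by
    rw [Real.exp_le_exp, div_mul_eq_mul_div, div_le_iff₀ hX0]
    exact mul_le_mul_of_nonneg_left (sum_exp_half_le h0 h1 hNM) hr0.le
  have hD : (s / (2 * r) : ℝ) ^ r ≤ s.choose r := by
    have e1 := Nat.pow_le_choose (α := ℝ) r s
    refine le_trans ?_ e1
    rw [le_div_iff₀ (by positivity)]
    have e2 : ((r.factorial : ℕ) : ℝ) ≤ (r : ℝ) ^ r := by exact_mod_cast Nat.factorial_le_pow r
    calc (s / (2 * r) : ℝ) ^ r * r.factorial ≤ (s / (2 * r) : ℝ) ^ r * (r : ℝ) ^ r := by gcongr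
      _ = (s / 2 : ℝ) ^ r := by rw [← mul_pow]; congr 1; field_simp
      _ ≤ ((s + 1 - r : ℕ) : ℝ) ^ r := by
        gcongr
        rw [div_le_iff₀ (by norm_num)]
        exact_mod_cast (by omega : s ≤ (s + 1 - r) * 2)
  have hP : 0 ≤ bernP p (Icc 1 M) (fun S => s ≤ #(missing (Ioc N M) S)) := bernP_nonneg h0.le h1
  have hE : bernP p (Icc 1 M) (fun S => s ≤ #(missing (Ioc N M) S)) * (s / (2 * r) : ℝ) ^ r ≤
      Real.exp r * ((r / X)⁻¹) ^ r :=
    (mul_le_mul_of_nonneg_left hD hP).trans (hA.trans (hB.trans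
      (mul_le_mul_of_nonneg_right hC (by positivity))))
  have hF : Real.exp r = Real.exp 1 ^ r := by rw [← Real.exp_nat_mul, mul_one]
  rw [← le_div_iff₀ (by positivity), hF, ← mul_pow, ← div_pow] at hE
  refine hE.trans ?_
  rw [show -(p ^ 2 * r * (N - 1) / 8) = r * (-(p ^ 2 * (N - 1) / 8)) by ring, Real.exp_nat_mul]
  refine pow_le_pow_left₀ (by positivity) ?_ r
  have e3 : Real.exp 1 * (r / X)⁻¹ / (s / (2 * r)) =
      Real.exp (-(p ^ 2 * (N - 1) / 8)) * (32 * Real.exp 1 / (p ^ 2 * s)) := by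
    rw [hX]
    field_simp
    ring
  rw [e3]
  -- The constant `90` in the hypothesis exceeds `32 e`.
  refine mul_le_of_le_one_right (Real.exp_pos _).le ?_
  rw [div_le_one (by positivity)]
  linarith [Real.exp_one_lt_d9]

/-- First moment bound. -/
lemma missingProb_le_div (p : I) {m : ℕ} (hp : 0 < (p : ℝ)) (hm : 1 ≤ m) :
    missingProb p m ≤ 32 / ((p : ℝ) ^ 2 * m) := by
  refine missingProb_le_of_forall p m 0 _ fun M _ => ?_
  have h1 : (p : ℝ) ≤ 1 := p.2.2
  have hA := bernP_card_missing_mul_choose_le hp.le h1 (subset_refl (Icc 1 M)) (r := 1) (s := m)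
    (by simpa using h1) hm
  have hI : Icc 1 M = Ioc 0 M := by ext x; simp only [mem_Icc, mem_Ioc]; omega
  have hm0 : (0 : ℝ) < m := by exact_mod_cast hm
  rw [powersetCard_one, sum_map, Nat.choose_one_right] at hA
  simp only [Function.Embedding.coeFn_mk, prod_singleton] at hA
  have hB := sum_exp_half_le hp h1 (Nat.zero_le M)
  rw [← hI] at hB
  have hC : Real.exp (-((p : ℝ) ^ 2 * ((0 : ℕ) - 1) / 8)) ≤ 2 := by
    have e : -((p : ℝ) ^ 2 * ((0 : ℕ) - 1) / 8) ≤ Real.log 2 := by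
      have := Real.log_two_gt_d9
      push_cast
      nlinarith
    calc _ ≤ Real.exp (Real.log 2) := Real.exp_le_exp.2 e
      _ = 2 := Real.exp_log (by norm_num)
  rw [← div_div, le_div_iff₀ hm0]
  refine hA.trans (hB.trans ((mul_le_mul_of_nonneg_right hC (by positivity)).trans_eq ?_))
  ring

end Moments

/-! ### The greedy container argument. -/

section Containers

open Finset

/-- If `S` is a random subset of `C` then, with high probability, either few elements of `D` avoid
all the sets `N y` with `y ∈ S`, or `S` misses almost all of the elements outside a small set. -/
theorem bernP_uncovered_le {α β : Type*} [DecidableEq α] [DecidableEq β] (N : α → Finset β) {p : ℝ}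
    (h0 : 0 ≤ p) (h1 : p ≤ 1 / 2) {t : ℕ} {d c l : ℝ} (hl : 0 ≤ l) (C : Finset α) (D : Finset β)
    (hstuck : ∀ C' ⊆ C, ∀ D' ⊆ D, t ≤ #D' → (∀ y ∈ C', (#(D' ∩ N y) : ℝ) ≤ d) → (#C' : ℝ) ≤ c) :
    bernP p C (fun S => t ≤ #(D \ S.biUnion N)) ≤
      Real.exp (l * #D + 2 * p * Real.exp (-(l * d)) * #C) * (1 - p) ^ ((#C : ℝ) - c) := by
  have h1' : p ≤ 1 := by linarith
  have hq : 0 < 1 - p := by linarith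
  induction C using Finset.strongInduction generalizing D with
  | H C ih =>
  -- Reveal an element `y` covering more than `d` points of `D`. Absence costs `1 - p`; presence
  -- shrinks `D` by at least `d`, which lowers the potential `exp (l * #D)` by `exp (-(l * d))`.
  by_cases hex : ∃ y ∈ C, d < (#(D ∩ N y) : ℝ)
  · obtain ⟨y, hy, hyd⟩ := hex
    set C' := C.erase y with hC'
    have hins : C = insert y C' := (insert_erase hy).symm
    have hyC' : y ∉ C' := notMem_erase y C
    have hsub : C' ⊆ C := erase_subset y C
    have ih1 := ih C' (erase_ssubset hy) D fun C'' hC'' => hstuck C'' (hC''.trans hsub)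
    have ih2 := ih C' (erase_ssubset hy) (D \ N y) fun C'' hC'' D'' hD'' =>
      hstuck C'' (hC''.trans hsub) D'' (hD''.trans sdiff_subset)
    have hcard : (#C : ℝ) = #C' + 1 := by
      rw [hins, card_insert_of_notMem hyC']
      push_cast; rfl
    have hDcard : (#(D \ N y) : ℝ) ≤ #D - d := by
      have : (#(D \ N y) : ℝ) + #(D ∩ N y) = #D := by
        exact_mod_cast card_sdiff_add_card_inter D (N y)
      linarith
    set μ := 2 * p * Real.exp (-(l * d)) with hμ
    have hμ0 : 0 ≤ μ := by positivity
    set E := Real.exp (l * #D + μ * #C') with hE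
    set R := (1 - p) ^ ((#C' : ℝ) - c) with hR
    have hE0 : 0 < E := Real.exp_pos _
    have hR0 : 0 < R := Real.rpow_pos_of_pos hq _
    have f1 : (1 - p) ^ ((#C : ℝ) - c) = (1 - p) * R := by
      rw [hcard, hR, show (#C' : ℝ) + 1 - c = 1 + (#C' - c) by ring, Real.rpow_add hq,
        Real.rpow_one]
    have f2 : Real.exp (l * #D + μ * #C) = E * Real.exp μ := by
      rw [hcard, hE, ← Real.exp_add]; ring_nf
    have f3 : Real.exp (l * #(D \ N y) + μ * #C') ≤ E * Real.exp (-(l * d)) := by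
      rw [hE, ← Real.exp_add, Real.exp_le_exp]
      nlinarith [mul_le_mul_of_nonneg_left hDcard hl]
    have f4 : bernP p C (fun S => t ≤ #(D \ S.biUnion N)) ≤
        (1 - p) * (E * R) + p * (E * Real.exp (-(l * d)) * R) := by
      conv_lhs => rw [hins]
      rw [bernP_insert hyC']
      have e : bernP p C' (fun S => t ≤ #(D \ (insert y S).biUnion N)) =
          bernP p C' (fun S => t ≤ #((D \ N y) \ S.biUnion N)) :=
        bernP_congr fun S _ => by rw [biUnion_insert, ← sup_eq_union, ← sdiff_sdiff_left]
      rw [e]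
      gcongr
      exact ih2.trans (mul_le_mul_of_nonneg_right f3 hR0.le)
    rw [f1, f2]
    refine f4.trans ?_
    have f5 := Real.add_one_le_exp μ
    -- Thus the presence branch multiplies the absence factor by at most `1 + μ`; the `2` in `μ`
    -- absorbs `1 / (1 - p)`.
    have f6 : p * Real.exp (-(l * d)) ≤ (1 - p) * μ := by
      rw [hμ]
      have := mul_nonneg h0 (Real.exp_pos (-(l * d))).le
      nlinarith
    calc (1 - p) * (E * R) + p * (E * Real.exp (-(l * d)) * R)
        = (E * R) * ((1 - p) + p * Real.exp (-(l * d))) := by ring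
      _ ≤ (E * R) * ((1 - p) * Real.exp μ) := by
        gcongr
        nlinarith
      _ = _ := by ring
  · push Not at hex
    by_cases hD : t ≤ #D
    -- The process is stuck, at most `c` elements are unrevealed, and the claimed bound is at least
    -- `1`.
    · have hc := hstuck C subset_rfl D subset_rfl hD hex
      refine (bernP_le_one h0 h1').trans ?_
      refine one_le_mul_of_one_le_of_one_le (Real.one_le_exp (by positivity)) ?_
      exact Real.one_le_rpow_of_pos_of_le_one_of_nonpos hq (by linarith) (by linarith)
    · rw [bernP_eq_zero fun S _ hS => hD (hS.trans (card_le_card sdiff_subset))]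
      positivity

/-- Once `F ⊆ S`, every `y ∈ S` covers `y + F`, so the greedy argument applies with these
neighbourhoods. When it is stuck, the pairs `(y, a) ∈ C' × F` with `y + a ∈ D'` number at most `d
N`, while each `a ≤ L` contributes at least `t - L - (N - #C')` of them; this bounds `#C'`. -/
lemma bernP_superset_missing_le {p : ℝ} (h0 : 0 ≤ p) (h1 : p ≤ 1 / 2) {N L t : ℕ} (hLN : L ≤ N)
    {F : Finset ℕ} (hF : F ⊆ Icc 1 L) (hF0 : 0 < #F) {d l : ℝ} (hd : 0 ≤ d) (hl : 0 ≤ l) :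
    bernP p (Icc 1 N) (fun S => F ⊆ S ∧ t ≤ #(missing (Icc 1 N) S)) ≤
      p ^ #F * (Real.exp (l * N + 2 * p * Real.exp (-(l * d)) * N) *
        (1 - p) ^ ((t : ℝ) - L - #F - d * N / #F)) := by
  have h1' : p ≤ 1 := by linarith
  have hq : 0 < 1 - p := by linarith
  have hFN : F ⊆ Icc 1 N := hF.trans (Icc_subset_Icc le_rfl hLN)
  have hk : (0 : ℝ) < #F := by exact_mod_cast hF0
  let nb : ℕ → Finset ℕ := fun y => F.image (y + ·)
  rw [bernP_superset_and hFN]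
  refine mul_le_mul_of_nonneg_left ?_ (by positivity)
  have hmono : bernP p (Icc 1 N \ F) (fun S => t ≤ #(missing (Icc 1 N) (S ∪ F))) ≤
      bernP p (Icc 1 N \ F) (fun S => t ≤ #(Icc 1 N \ S.biUnion nb)) := by
    refine bernP_mono h0 h1' fun S _ hS => hS.trans (card_le_card ?_)
    refine sdiff_subset_sdiff subset_rfl fun z hz => ?_
    obtain ⟨y, hy, hz⟩ := mem_biUnion.1 hz
    obtain ⟨a, ha, rfl⟩ := mem_image.1 hz
    exact add_mem_add (mem_union_left _ hy) (mem_union_right _ ha)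
  refine hmono.trans ?_
  refine (bernP_uncovered_le nb h0 h1 (d := d) (c := N - ((t : ℝ) - L) + d * N / #F) hl _ _
    ?_).trans ?_
  · intro C' hC' D' hD' ht hy
    have hC'N : C' ⊆ Icc 1 N := hC'.trans sdiff_subset
    have hC'card : (#C' : ℝ) ≤ N := by
      have := card_le_card hC'N
      rw [Nat.card_Icc, Nat.add_sub_cancel] at this
      exact_mod_cast this
    have e1 : ((∑ a ∈ F, #{y ∈ C' | y + a ∈ D'} : ℕ) : ℝ) ≤ d * N := by
      have : ∑ a ∈ F, #{y ∈ C' | y + a ∈ D'} = ∑ y ∈ C', #{a ∈ F | y + a ∈ D'} := by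
        simp only [card_filter]
        exact sum_comm
      rw [this, Nat.cast_sum]
      calc ∑ y ∈ C', (#{a ∈ F | y + a ∈ D'} : ℝ) ≤ ∑ y ∈ C', d := by
            refine sum_le_sum fun y hyC => le_trans ?_ (hy y hyC)
            refine Nat.cast_le.2 (card_le_card_of_injOn (y + ·) (fun a ha => ?_)
              fun a _ b _ hab => Nat.add_left_cancel hab)
            have ha := mem_filter.1 ha
            exact mem_inter.2 ⟨ha.2, mem_image_of_mem _ ha.1⟩
        _ = #C' * d := by rw [sum_const, nsmul_eq_mul]
        _ ≤ d * N := by rw [mul_comm]; gcongr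
    have e2 : ∀ a ∈ F, (t : ℝ) - L - (N - #C') ≤ #{y ∈ C' | y + a ∈ D'} := by
      intro a ha
      have haL := mem_Icc.1 (hF ha)
      have g1 : #D' ≤ #{z ∈ D' | a < z} + a := by
        have : D' ⊆ {z ∈ D' | a < z} ∪ Icc 1 a := fun z hz => by
          have := mem_Icc.1 (hD' hz)
          simp only [mem_union, mem_filter, mem_Icc]
          by_cases h : a < z
          · exact Or.inl ⟨hz, h⟩
          · exact Or.inr (by omega)
        refine (card_le_card this).trans ((card_union_le _ _).trans ?_)
        simp
      have g2 : #{z ∈ D' | a < z} ≤ #{y ∈ C' | y + a ∈ D'} + #(Icc 1 N \ C') := by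
        have : #{z ∈ D' | a < z} ≤ #({y ∈ C' | y + a ∈ D'} ∪ (Icc 1 N \ C')) := by
          refine card_le_card_of_injOn (· - a) (fun z hz => ?_) fun z hz z' hz' h => ?_
          · obtain ⟨hz, haz⟩ := mem_filter.1 hz
            have hzN := mem_Icc.1 (hD' hz)
            have hmem : z - a ∈ Icc 1 N := mem_Icc.2 (by omega)
            change z - a ∈ ({y ∈ C' | y + a ∈ D'} ∪ (Icc 1 N \ C'))
            by_cases hzC : z - a ∈ C'
            · refine mem_union_left _ (mem_filter.2 ⟨hzC, ?_⟩)
              rwa [Nat.sub_add_cancel haz.le]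
            · exact mem_union_right _ (mem_sdiff.2 ⟨hmem, hzC⟩)
          · have hz := (mem_filter.1 hz).2
            have hz' := (mem_filter.1 hz').2
            simp only at h
            omega
        exact this.trans (card_union_le _ _)
      have g3 : (#(Icc 1 N \ C') : ℝ) = N - #C' := by
        rw [card_sdiff_of_subset hC'N, Nat.cast_sub (card_le_card hC'N)]
        simp
      have g1' : (#D' : ℝ) ≤ #{z ∈ D' | a < z} + a := by exact_mod_cast g1
      have g2' : (#{z ∈ D' | a < z} : ℝ) ≤ #{y ∈ C' | y + a ∈ D'} + #(Icc 1 N \ C') := by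
        exact_mod_cast g2
      have g4 : (a : ℝ) ≤ L := by exact_mod_cast haL.2
      have g5 : (t : ℝ) ≤ #D' := by exact_mod_cast ht
      linarith
    have e3 := card_nsmul_le_sum F (fun a => (#{y ∈ C' | y + a ∈ D'} : ℝ)) _ e2
    rw [nsmul_eq_mul] at e3
    rw [Nat.cast_sum] at e1
    have e4 : (t : ℝ) - L - (N - #C') ≤ d * N / #F := by
      rw [le_div_iff₀ hk]
      linarith
    linarith
  · have hc : (#(Icc 1 N \ F) : ℝ) = N - #F := by
      rw [card_sdiff_of_subset hFN, Nat.cast_sub (card_le_card hFN)]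
      simp
    rw [hc, show (N : ℝ) - #F - (N - ((t : ℝ) - L) + d * N / #F) = t - L - #F - d * N / #F by ring]
    refine mul_le_mul_of_nonneg_right ?_ (by positivity)
    rw [Real.exp_le_exp]
    simp only [Nat.card_Icc, Nat.add_sub_cancel]
    gcongr
    linarith

/-- The two terms are the cases of fewer than `k` elements in `[1, L]`, and of some `k`-set `F`
there, with a union bound over `F`. -/
lemma bernP_card_missing_Icc_le {p : ℝ} (h0 : 0 ≤ p) (h1 : p ≤ 1 / 2) {N L t k : ℕ} (hLN : L ≤ N)
    (hk : 0 < k) {d l x : ℝ} (hd : 0 ≤ d) (hl : 0 ≤ l) (hx : 0 < x) (hx1 : x ≤ 1) :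
    bernP p (Icc 1 N) (fun S => t ≤ #(missing (Icc 1 N) S)) ≤
      (1 - p) ^ L * Real.exp (2 * p * x * L) * (x⁻¹) ^ k +
      Real.exp (p * x * L) * (x⁻¹) ^ k * (Real.exp (l * N + 2 * p * Real.exp (-(l * d)) * N) *
        (1 - p) ^ ((t : ℝ) - L - k - d * N / k)) := by
  have h1' : p ≤ 1 := by linarith
  have hq : 0 < 1 - p := by linarith
  have hsub : Icc 1 L ⊆ Icc 1 N := Icc_subset_Icc le_rfl hLN
  set B := Real.exp (l * N + 2 * p * Real.exp (-(l * d)) * N) *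
        (1 - p) ^ ((t : ℝ) - L - k - d * N / k) with hB
  have hB0 : 0 ≤ B := by positivity
  calc bernP p (Icc 1 N) (fun S => t ≤ #(missing (Icc 1 N) S))
      ≤ bernP p (Icc 1 N) (fun S => #(S ∩ Icc 1 L) < k ∨
          ∃ F ∈ (Icc 1 L).powersetCard k, F ⊆ S ∧ t ≤ #(missing (Icc 1 N) S)) := by
        refine bernP_mono h0 h1' fun S _ hS => ?_
        rcases lt_or_ge #(S ∩ Icc 1 L) k with h | h
        · exact Or.inl h
        · obtain ⟨F, hF, hFk⟩ := exists_subset_card_eq h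
          exact Or.inr ⟨F, mem_powersetCard.2 ⟨hF.trans inter_subset_right, hFk⟩,
            hF.trans inter_subset_left, hS⟩
    _ ≤ bernP p (Icc 1 N) (fun S => #(S ∩ Icc 1 L) < k) +
          ∑ F ∈ (Icc 1 L).powersetCard k,
            bernP p (Icc 1 N) (fun S => F ⊆ S ∧ t ≤ #(missing (Icc 1 N) S)) := by
        refine (bernP_or_le h0 h1').trans ?_
        gcongr
        exact bernP_exists_le h0 h1' _ _
    _ ≤ (1 - p) ^ L * Real.exp (2 * p * x * L) * (x⁻¹) ^ k + ∑ F ∈ (Icc 1 L).powersetCard k,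
          p ^ k * B := by
        gcongr with F hF
        · have e1 : bernP p (Icc 1 N) (fun S => #(S ∩ Icc 1 L) < k) =
              bernP p (Icc 1 L) (fun S => #(S ∩ Icc 1 L) < k) :=
            bernP_restrict hsub fun S _ => by rw [inter_assoc, inter_self]
          have e2 : bernP p (Icc 1 L) (fun S => #(S ∩ Icc 1 L) < k) =
              bernP p (Icc 1 L) (fun S => #S < k) :=
            bernP_congr fun S hS => by rw [inter_eq_left.2 hS]
          rw [e1, e2]
          have := bernP_card_lt (V := Icc 1 L) h0 h1 k hx hx1
          simpa using this
        · rw [mem_powersetCard] at hF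
          have := bernP_superset_missing_le h0 h1 hLN hF.1 (by omega) hd hl (t := t)
          rwa [hF.2] at this
    _ = (1 - p) ^ L * Real.exp (2 * p * x * L) * (x⁻¹) ^ k + (L.choose k * p ^ k) * B := by
        simp [mul_assoc]
    _ ≤ _ := by
        have := mul_le_mul_of_nonneg_right (choose_mul_pow_le h0 hx L k) hB0
        linarith

end Containers

/-! ### Lower bounds and the threshold. -/

section LowerBounds

open Finset

lemma missingProb_le_one (p : I) (m : ℕ) : missingProb p m ≤ 1 := measureReal_le_one

lemma pow_half_le_missingProb (p : I) (m : ℕ) : (1 - (p : ℝ)) ^ (m / 2) ≤ missingProb p m := by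
  have h0 : 0 ≤ (p : ℝ) := p.2.1
  have h1 : (p : ℝ) ≤ 1 := p.2.2
  refine le_trans ?_ (bernP_missing_le_missingProb p m m)
  have hsub : Icc 1 (m / 2) ⊆ Icc 1 m := Icc_subset_Icc le_rfl (Nat.div_le_self m 2)
  have h := bernP_disjoint_and (p := (p : ℝ)) (Q := fun _ => True) hsub
  have hone : bernP (p : ℝ) (Icc 1 m \ Icc 1 (m / 2)) (fun _ => True) = 1 := by
    simp [bernP, bernE_const]
  rw [hone, Nat.card_Icc, Nat.add_sub_cancel, mul_one] at h
  rw [← h]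
  refine bernP_mono h0 h1 fun S hS hd => ?_
  have : missing (Icc 1 m) S = Icc 1 m := by
    refine subset_antisymm (missing_subset _ _) fun n hn => mem_missing.2 ⟨hn, ?_⟩
    have large : ∀ x ∈ S, m / 2 < x := fun x hx => by
      by_contra hlt
      have h3 := mem_Icc.1 (hS hx)
      exact disjoint_left.1 hd.1 hx (mem_Icc.2 (by omega))
    intro x hx y hy hxy
    have := mem_Icc.1 hn
    have := large x hx
    have := large y hy
    omega
  rw [this, Nat.card_Icc, Nat.add_sub_cancel]

lemma rpow_half_le_missingProb (p : I) (m : ℕ) :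
    (1 - (p : ℝ)) ^ ((m : ℝ) / 2) ≤ missingProb p m := by
  have h0 : 0 ≤ (p : ℝ) := p.2.1
  have h1 : (p : ℝ) ≤ 1 := p.2.2
  refine le_trans ?_ (pow_half_le_missingProb p m)
  rw [← Real.rpow_natCast]
  exact Real.rpow_le_rpow_of_exponent_ge' (by linarith) (by linarith) (by positivity)
    Nat.cast_div_le

/-- A sparse random set has too few elements for its sumset to be large. -/
lemma one_sub_pow_le_missingProb (p : I) {m : ℕ} (hm : 1 ≤ m) :
    1 - (2 * Real.exp 1 * ((p : ℝ) * √m)) ^ ⌈√(m : ℝ)⌉₊ ≤ missingProb p m := by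
  have h0 : 0 ≤ (p : ℝ) := p.2.1
  have h1 : (p : ℝ) ≤ 1 := p.2.2
  have hm0 : (0 : ℝ) < m := by exact_mod_cast hm
  have hs : 0 < √(m : ℝ) := Real.sqrt_pos.2 hm0
  set k := ⌈√(m : ℝ)⌉₊ with hk
  have hk1 : √(m : ℝ) ≤ k := Nat.le_ceil _
  have hk0 : (0 : ℝ) < k := hs.trans_le hk1
  refine le_trans ?_ (bernP_missing_le_missingProb p m (2 * m))
  have hsum := bernP_add_not (p := (p : ℝ)) (V := Icc 1 (2 * m))
    (Q := fun S => m ≤ #(missing (Icc 1 (2 * m)) S))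
  -- Since `#(S + S) ≤ #S ^ 2`, missing fewer than `m` of `2 * m` elements forces `#S ≥ √m`.
  have hA : bernP (p : ℝ) (Icc 1 (2 * m)) (fun S => ¬ m ≤ #(missing (Icc 1 (2 * m)) S)) ≤
      bernP (p : ℝ) (Icc 1 (2 * m)) (fun S => k ≤ #S) := by
    refine bernP_mono h0 h1 fun S _ hS => ?_
    have e1 := le_card_sdiff (S + S) (Icc 1 (2 * m))
    rw [Nat.card_Icc] at e1
    have e2 : #(S + S) ≤ #S * #S := card_add_le
    have e3 : #((Icc 1 (2 * m)) \ (S + S)) < m := not_le.1 hS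
    have e4 : m ≤ #S * #S := by omega
    refine Nat.ceil_le.2 (Real.sqrt_le_iff.2 ⟨by positivity, ?_⟩)
    rw [sq]
    exact_mod_cast e4
  have hB : bernP (p : ℝ) (Icc 1 (2 * m)) (fun S => k ≤ #S) ≤
      (2 * Real.exp 1 * ((p : ℝ) * √m)) ^ k := by
    refine (bernP_card_ge h0 h1 k).trans ?_
    rw [Nat.card_Icc, Nat.add_sub_cancel]
    have e1 := Nat.choose_le_pow_div (α := ℝ) k (2 * m)
    have e2 := Real.pow_div_factorial_le_exp (k : ℝ) hk0.le k
    have e3 : ((k.factorial : ℕ) : ℝ)⁻¹ ≤ Real.exp 1 ^ k / (k : ℝ) ^ k := by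
      rw [← Real.exp_nat_mul, mul_one, le_div_iff₀ (by positivity), inv_mul_eq_div]
      exact e2
    calc ((2 * m).choose k : ℝ) * (p : ℝ) ^ k
        ≤ (((2 * m : ℕ) : ℝ) ^ k / (k.factorial : ℕ)) * (p : ℝ) ^ k := by gcongr
      _ = (((2 * m : ℕ) : ℝ) * p) ^ k * ((k.factorial : ℕ) : ℝ)⁻¹ := by
        rw [mul_pow]; ring
      _ ≤ (((2 * m : ℕ) : ℝ) * p) ^ k * (Real.exp 1 ^ k / (k : ℝ) ^ k) := by gcongr
      _ = (((2 * m : ℕ) : ℝ) * p * Real.exp 1 / k) ^ k := by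
        rw [div_pow, mul_pow _ (Real.exp 1), mul_div_assoc]
      _ ≤ _ := by
        refine pow_le_pow_left₀ (by positivity) ?_ k
        rw [div_le_iff₀ hk0]
        have e4 : (m : ℝ) ≤ √m * k := by
          calc (m : ℝ) = √m * √m := (Real.mul_self_sqrt hm0.le).symm
            _ ≤ √m * k := by gcongr
        have e5 := mul_le_mul_of_nonneg_left e4
          (by positivity : 0 ≤ 2 * Real.exp 1 * (p : ℝ))
        push_cast
        linarith
  linarith

lemma tendsto_missingProb_one {p : ℕ → I}
    (h : Tendsto (fun m : ℕ => (p m : ℝ) * √(m : ℝ)) atTop (𝓝 0)) :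
    Tendsto (fun m : ℕ => missingProb (p m) m) atTop (𝓝 1) := by
  have h2 : Tendsto (fun m : ℕ => 2 * Real.exp 1 * ((p m : ℝ) * √(m : ℝ))) atTop (𝓝 0) := by
    simpa using h.const_mul (2 * Real.exp 1)
  have h3 : Tendsto (fun m : ℕ => 1 - 2 * Real.exp 1 * ((p m : ℝ) * √(m : ℝ))) atTop (𝓝 1) := by
    simpa using h2.const_sub 1
  refine tendsto_of_tendsto_of_tendsto_of_le_of_le' h3 tendsto_const_nhds ?_
    (Eventually.of_forall fun m => missingProb_le_one _ _)
  filter_upwards [h2.eventually_le_const one_pos, eventually_ge_atTop 1] with m ha hm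
  have hm0 : (0 : ℝ) < m := by exact_mod_cast hm
  have hp : 0 ≤ (p m : ℝ) := (p m).2.1
  refine le_trans ?_ (one_sub_pow_le_missingProb (p m) hm)
  refine sub_le_sub_left (pow_le_of_le_one (by positivity) ha ?_) 1
  exact (Nat.ceil_pos.2 (Real.sqrt_pos.2 hm0)).ne'

lemma tendsto_missingProb_zero {p : ℕ → I}
    (h : Tendsto (fun m : ℕ => (p m : ℝ) * √(m : ℝ)) atTop atTop) :
    Tendsto (fun m : ℕ => missingProb (p m) m) atTop (𝓝 0) := by
  have h2 : Tendsto (fun m : ℕ => 32 / ((p m : ℝ) * √(m : ℝ)) ^ 2) atTop (𝓝 0) :=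
    tendsto_const_nhds.div_atTop ((tendsto_pow_atTop two_ne_zero).comp h)
  refine tendsto_of_tendsto_of_tendsto_of_le_of_le' tendsto_const_nhds h2
    (Eventually.of_forall fun m => measureReal_nonneg) ?_
  filter_upwards [h.eventually_gt_atTop 0, eventually_ge_atTop 1] with m hpos hm
  have hp : 0 < (p m : ℝ) := pos_of_mul_pos_left hpos (Real.sqrt_nonneg _)
  rw [mul_pow, Real.sq_sqrt (Nat.cast_nonneg m)]
  exact missingProb_le_div (p m) hp hm

/-- With `x = p √m`, the constant `1 / (4 e)` makes the base `2 e x` at most `1/2`. Both sides tend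
to `1` as `p → 0`, so the two errors are compared to first order in `x`. -/
lemma exists_lt_missingProb {ε : ℝ} (hε : 0 < ε) (hε2 : ε < 1 / 2) :
    ∃ m₀ : ℕ, ∀ (m : ℕ) (p : I), m₀ ≤ m → 0 < (p : ℝ) →
      (p : ℝ) ≤ (1 / (4 * Real.exp 1)) / √(m : ℝ) →
      (1 - (p : ℝ)) ^ ((m : ℝ) / 2 - ε * (m : ℝ)) < missingProb p m := by
  set h := 1 / 2 - ε with hh
  have hh0 : 0 < h := by linarith
  have hlim : Tendsto (fun m : ℕ => 24 * (1 / 2 : ℝ) ^ ⌈√(m : ℝ)⌉₊) atTop (𝓝 0) := by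
    have e1 : Tendsto (fun m : ℕ => ⌈√(m : ℝ)⌉₊) atTop atTop :=
      tendsto_nat_ceil_atTop.comp (Real.tendsto_sqrt_atTop.comp tendsto_natCast_atTop_atTop)
    have e2 := (tendsto_pow_atTop_nhds_zero_of_lt_one (r := (1 / 2 : ℝ)) (by norm_num)
      (by norm_num)).comp e1
    simpa using e2.const_mul 24
  obtain ⟨m₀, hm₀⟩ := eventually_atTop.1
    ((hlim.eventually_lt_const hh0).and (eventually_ge_atTop 1))
  refine ⟨m₀, fun m p hm hp hpc => ?_⟩
  obtain ⟨hk, hm1⟩ := hm₀ m hm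
  have hp1 : (p : ℝ) ≤ 1 := p.2.2
  have hm0 : (1 : ℝ) ≤ m := by exact_mod_cast hm1
  have hs : 1 ≤ √(m : ℝ) := Real.one_le_sqrt.2 hm0
  have hss : √(m : ℝ) * √(m : ℝ) = m := Real.mul_self_sqrt (by linarith)
  refine lt_of_lt_of_le ?_ (one_sub_pow_le_missingProb p hm1)
  set k := ⌈√(m : ℝ)⌉₊
  have he : 0 < Real.exp 1 := Real.exp_pos 1
  have hx : (p : ℝ) * √m ≤ 1 / (4 * Real.exp 1) := (le_div_iff₀ (by linarith)).1 hpc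
  set x := (p : ℝ) * √m with hxdef
  have hx0 : 0 < x := by positivity
  set a := 2 * Real.exp 1 * x with ha
  have ha0 : 0 < a := by positivity
  have ha1 : a ≤ 1 / 2 := by
    rw [le_div_iff₀ (by positivity)] at hx
    linarith
  have hx1 : x ≤ 1 := by
    have : 1 < Real.exp 1 := by linarith [Real.exp_one_gt_d9]
    nlinarith
  obtain ⟨j, hj⟩ : ∃ j, k = j + 1 :=
    ⟨k - 1, (Nat.succ_pred_eq_of_pos (Nat.ceil_pos.2 (by linarith))).symm⟩
  -- One factor `a ≤ 6 x` is kept aside to make the error linear in `x`.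
  have hak : a ^ k ≤ 12 * x * (1 / 2 : ℝ) ^ k := by
    rw [hj, pow_succ, pow_succ]
    have e1 : a ^ j ≤ (1 / 2 : ℝ) ^ j := pow_le_pow_left₀ ha0.le ha1 j
    have e2 : a ≤ 6 * x := by
      rw [ha]
      have := Real.exp_one_lt_d9
      nlinarith
    calc a ^ j * a ≤ (1 / 2 : ℝ) ^ j * (6 * x) := by gcongr
      _ = _ := by ring
  have hy : (p : ℝ) * (m / 2 - ε * m) = x * √m * h := by
    rw [hxdef, hh, mul_assoc (p : ℝ), hss]; ring
  set y := x * √m * h with hydef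
  have hy0 : 0 < y := by positivity
  have hbase : (1 - (p : ℝ)) ^ ((m : ℝ) / 2 - ε * m) ≤ Real.exp (-y) := by
    rw [← hy, ← neg_mul, Real.exp_mul]
    refine Real.rpow_le_rpow (by linarith) ?_ ?_
    · linarith [Real.add_one_le_exp (-(p : ℝ))]
    · have : (m : ℝ) / 2 - ε * m = h * m := by rw [hh]; ring
      rw [this]; positivity
  have hexp : Real.exp (-y) ≤ 1 - x * h / 2 := by
    have e1 : Real.exp (-y) ≤ 1 / (1 + y) := by
      rw [Real.exp_neg, ← one_div]
      refine one_div_le_one_div_of_le (by linarith) ?_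
      linarith [Real.add_one_le_exp y]
    refine e1.trans ?_
    rw [div_le_iff₀ (by linarith)]
    have e2 : y ≤ √m := by
      rw [hydef]
      have : x * √(m : ℝ) ≤ 1 * √m := by gcongr
      nlinarith
    have e3 : x * h / 2 * (1 + y) ≤ x * h / 2 * (2 * √m) := by gcongr; linarith
    have e4 : x * h / 2 * (2 * √m) = y := by rw [hydef]; ring
    linarith
  have hfin : a ^ k < x * h / 2 := by
    refine lt_of_le_of_lt hak ?_
    nlinarith
  linarith

end LowerBounds

/-! ### Choice of parameters and the main upper bound. -/

section UpperBound

open Finset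

lemma neg_log_one_sub_le {q : ℝ} (h0 : 0 ≤ q) (h1 : q ≤ 1 / 2) :
    -Real.log (1 - q) ≤ 2 * q := by
  have h := Real.one_sub_inv_le_log_of_pos (by linarith : 0 < 1 - q)
  have e : (1 - q)⁻¹ ≤ 1 + 2 * q := by
    rw [inv_le_iff_one_le_mul₀ (by linarith)]
    nlinarith
  linarith

lemma exp_neg_two_le : Real.exp (-2) ≤ 1 / 4 := by
  rw [Real.exp_neg, one_div]
  refine inv_anti₀ (by norm_num) ?_
  rw [show (2 : ℝ) = (2 : ℕ) * 1 by norm_num, Real.exp_nat_mul]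
  have := Real.exp_one_gt_d9
  nlinarith

lemma log_le_eight {b : ℝ} (hb : 0 < b) (hb2 : b ≤ 2.7 ^ 8) : Real.log b ≤ 8 := by
  rw [Real.log_le_iff_le_exp hb]
  refine hb2.trans ?_
  rw [show (8 : ℝ) = (8 : ℕ) * 1 by norm_num, Real.exp_nat_mul]
  exact pow_le_pow_left₀ (by norm_num) (by linarith [Real.exp_one_gt_d9]) 8

set_option maxHeartbeats 2000000 in
/-- The main upper bound. -/
theorem missingProb_lt {m : ℕ} {ε : ℝ} {p : I} (hm : 1 ≤ m) (hε : 0 < ε) (hε2 : ε ≤ 1 / 2)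
    (hp : 0 < (p : ℝ)) (hp2 : (p : ℝ) ≤ 1 / 2)
    (hC : 10 ^ 5 * Real.logb 2 (1 / ε) / √(ε ^ 3 * (m : ℝ)) ≤ (p : ℝ)) :
    missingProb p m < (1 - (p : ℝ)) ^ ((m : ℝ) / 2 - ε * (m : ℝ)) := by
  obtain ⟨q, hq⟩ : ∃ q : ℝ, q = (p : ℝ) := ⟨_, rfl⟩
  obtain ⟨ℓ, hℓ⟩ : ∃ ℓ : ℝ, ℓ = Real.logb 2 (1 / ε) := ⟨_, rfl⟩
  have hm0 : (1 : ℝ) ≤ m := by exact_mod_cast hm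
  have hq0 : 0 < q := hq ▸ hp
  have hq2 : q ≤ 1 / 2 := hq ▸ hp2
  have hinv : 2 ≤ 1 / ε := by rw [le_div_iff₀ hε]; linarith
  have hℓ1 : 1 ≤ ℓ := by
    rw [hℓ, Real.le_logb_iff_rpow_le (by norm_num) (by positivity)]
    simpa using hinv
  have hlogε : Real.log (1 / ε) ≤ ℓ := by
    have e : Real.log (1 / ε) = ℓ * Real.log 2 := by
      rw [hℓ, Real.logb, div_mul_cancel₀ _ (Real.log_pos (by norm_num)).ne']
    rw [e]
    nlinarith [Real.log_two_lt_d9]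
  -- the main hypothesis, squared
  have hmain : 10 ^ 10 * ℓ ^ 2 ≤ q ^ 2 * (ε ^ 3 * m) := by
    rw [← hℓ, ← hq, div_le_iff₀ (Real.sqrt_pos.2 (by positivity))] at hC
    have e1 := pow_le_pow_left₀ (by positivity) hC 2
    rw [mul_pow, mul_pow, Real.sq_sqrt (by positivity)] at e1
    linarith
  -- `η` is the slack in the exponent: every error term is compared with it.
  set η := q * ε * m with hη
  have hη0 : 0 < η := by positivity
  have hηmain : 10 ^ 10 * ℓ ^ 2 ≤ q * ε ^ 2 * η := by rw [hη]; linarith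
  have hqε : q * ε ^ 2 ≤ 1 / 8 := by nlinarith
  have hηℓ : 8 * (10 ^ 10 * ℓ ^ 2) ≤ η := by nlinarith
  have hηℓ1 : 10 ^ 10 * ℓ ≤ η := by nlinarith
  have hη1 : 10 ^ 10 ≤ η := by linarith
  -- the parameters
  set x := ε / (1024 * ℓ) with hx
  have hx0 : 0 < x := by positivity
  have hxε : x ≤ ε / 1024 := by
    rw [hx]
    exact div_le_div_of_nonneg_left hε.le (by norm_num) (by linarith)
  have hx1 : x ≤ 1 := by linarith
  have hxqm : x * (q * m) * (1024 * ℓ) = η := by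
    rw [hx, hη]; field_simp
  have hxqm1 : 1 ≤ x * (q * m) := by nlinarith
  have hxqm2 : x * (q * m) ≤ η / 1024 := by
    have : x * (q * m) ≤ ε / 1024 * (q * m) := by gcongr
    rw [hη]; linarith
  set k := ⌈x * (q * m)⌉₊ with hk
  have hk1 : x * (q * m) ≤ k := Nat.le_ceil _
  have hk2 : (k : ℝ) ≤ 2 * (x * (q * m)) := by
    have := Nat.ceil_lt_add_one (by positivity : 0 ≤ x * (q * m))
    linarith
  have hk0 : (0 : ℝ) < k := by linarith
  have hkε : (k : ℝ) ≤ ε * m / 1000 := by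
    have : x * (q * m) ≤ ε / 1024 * (1 / 2 * m) := by gcongr
    have : 0 < ε * m := by positivity
    linarith
  set s := ⌈ε * m / 4⌉₊ with hs
  have hs1 : ε * m / 4 ≤ s := Nat.le_ceil _
  have hs2 : (s : ℝ) ≤ ε * m / 4 + 1 :=
    (Nat.ceil_lt_add_one (by positivity : 0 ≤ ε * m / 4)).le
  -- Chosen so that the double-counting loss `d * (40 m) / k` equals `ε m / 8`.
  set d := ε / 320 * k with hd
  have hd0 : 0 < d := by positivity
  set Y := Real.log (2560 / ε) with hY
  have hYpos : 0 < Y := Real.log_pos (by rw [lt_div_iff₀ hε]; linarith)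
  have hY9 : Y ≤ 9 * ℓ := by
    rw [hY, div_eq_mul_one_div, Real.log_mul (by norm_num) (by positivity)]
    have := log_le_eight (b := 2560) (by norm_num) (by norm_num)
    linarith
  -- Chosen so that `exp (-(l * d)) = ε / 2560`, which makes the correction `2 q exp (-(l d)) * (40
  -- m)` equal to `η / 32`.
  set l := Y / d with hl
  have hl0 : 0 < l := by positivity
  have hld : Real.exp (-(l * d)) = ε / 2560 := by
    rw [hl, div_mul_cancel₀ _ hd0.ne', hY, Real.exp_neg, Real.exp_log (by positivity), inv_div]
  have hlogx : Real.log x⁻¹ ≤ 10 * ℓ := by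
    have e : x⁻¹ = 1024 * (ℓ * (1 / ε)) := by rw [hx]; field_simp
    rw [e, Real.log_mul (by norm_num) (by positivity), Real.log_mul (by positivity) (by positivity)]
    have e1 := log_le_eight (b := 1024) (by norm_num) (by norm_num)
    have e2 := Real.log_le_sub_one_of_pos (by linarith : 0 < ℓ)
    linarith
  have hxk : (x⁻¹) ^ k ≤ Real.exp (η / 50) := by
    rw [← Real.exp_log (inv_pos.2 hx0), ← Real.exp_nat_mul, Real.exp_le_exp]
    calc (k : ℝ) * Real.log x⁻¹ ≤ k * (10 * ℓ) := by gcongr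
      _ ≤ (2 * (x * (q * m))) * (10 * ℓ) := by gcongr
      _ = η * (20 / 1024) := by rw [← hxqm]; ring
      _ ≤ η / 50 := by linarith
  -- The left side is of order `ℓ ^ 2 / (q ε ^ 2)`; this dictates the shape `ℓ / √(ε ^ 3 m)` of the
  -- lower bound on `p`.
  have hlN : l * ((40 * m : ℕ) : ℝ) ≤ η / 32 := by
    have e1 : l * ((40 * m : ℕ) : ℝ) = Y * 12800 * m / (ε * k) := by
      rw [hl, hd]; push_cast; field_simp; norm_num
    rw [e1, div_le_iff₀ (by positivity)]
    have e2 : η * (ε * (x * (q * m))) ≤ η * (ε * k) := by gcongr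
    have e3 : η * (ε * (x * (q * m))) = q * ε ^ 2 * η * (m / (1024 * ℓ)) := by
      rw [hx]; ring
    have e4 : 10 ^ 10 * ℓ ^ 2 * (m / (1024 * ℓ)) ≤ q * ε ^ 2 * η * (m / (1024 * ℓ)) := by gcongr
    have e5 : 10 ^ 10 * ℓ ^ 2 * (m / (1024 * ℓ)) = 9765625 * (ℓ * m) := by field_simp; norm_num
    have e6 : Y * m ≤ 9 * ℓ * m := by gcongr
    have e7 : 9765625 * (ℓ * m) ≤ η * (ε * k) := by
      rw [← e5]
      exact e4.trans (e3.symm.le.trans e2)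
    have e8 : 0 < ℓ * m := by positivity
    linarith only [e6, e7, e8]
  -- the target
  set G := -Real.log (1 - q) with hG
  have hGq : q ≤ G := by
    have := Real.log_le_sub_one_of_pos (by linarith : 0 < 1 - q)
    linarith
  have hG2 : G ≤ 2 * q := neg_log_one_sub_le hq0.le hq2
  have hrpow : ∀ z : ℝ, (1 - q) ^ z = Real.exp (-(G * z)) := fun z => by
    rw [Real.rpow_def_of_pos (by linarith), hG]; ring_nf
  have hGη : η ≤ G * (ε * m) := by
    rw [hη, mul_assoc]; gcongr
  have hG0 : 0 < G := by linarith
  obtain ⟨B, hB⟩ : ∃ B : ℝ, B = Real.exp (-(G * (m / 2 - ε * m))) := ⟨_, rfl⟩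
  have hB0 : 0 < B := hB ▸ Real.exp_pos _
  have hpart : ∀ z : ℝ, z ≤ -(G * (m / 2 - ε * m)) - 2 → Real.exp z ≤ B / 4 := fun z hz => by
    have e1 : Real.exp z ≤ B * Real.exp (-2) := by
      rw [hB, ← Real.exp_add, Real.exp_le_exp]; linarith
    have e2 := mul_le_mul_of_nonneg_left exp_neg_two_le hB0.le
    linarith
  -- the elements beyond `40 * m`
  have hfar : ∀ M ≥ 40 * m, bernP q (Icc 1 M) (fun S => s ≤ #(missing (Ioc (40 * m) M) S)) ≤
      B / 4 := by
    intro M hM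
    -- The largest `r` with `q r ≤ 1`; then `q ^ 2 r ≥ q / 2`, and the decay `exp (-39 q m / 16)`
    -- beats `(1 - q) ^ (m / 2) ≥ exp (-q m)`.
    set r := ⌊1 / q⌋₊ with hr
    have hr1 : (r : ℝ) ≤ 1 / q := Nat.floor_le (by positivity)
    have hr2 : 1 / q < r + 1 := Nat.lt_floor_add_one _
    rw [le_div_iff₀ hq0] at hr1
    rw [div_lt_iff₀ hq0] at hr2
    have hrpos : 1 ≤ r := Nat.le_floor (by rw [Nat.cast_one, le_div_iff₀ hq0]; linarith)
    have h2rs : 2 * r ≤ s := by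
      have : (2 * r : ℝ) ≤ s := by
        refine le_trans ?_ hs1
        have e1 : 2 * r * q ≤ ε * m / 4 * q := by
          have : ε * m / 4 * q = η / 4 := by rw [hη]; ring
          linarith
        exact le_of_mul_le_mul_right e1 hq0
      exact_mod_cast this
    have hps : 90 ≤ q ^ 2 * s := by
      have e1 : q ^ 2 * (ε * m / 4) ≤ q ^ 2 * s := by gcongr
      have e2 : q ^ 2 * (ε ^ 3 * m) ≤ q ^ 2 * (ε * m) := by
        gcongr
        exact pow_le_of_le_one hε.le (by linarith) three_ne_zero
      have e3 : 1 ≤ ℓ ^ 2 := one_le_pow₀ hℓ1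
      linarith
    refine (bernP_card_missing_Ioc_le hq0 (by linarith) hM hrpos (by linarith) h2rs hps).trans
      (hpart _ ?_)
    have e1 : q * (1 / 2) * (39 * m) / 8 ≤ q ^ 2 * r * (((40 * m : ℕ) : ℝ) - 1) / 8 := by
      have e2 : q * (1 / 2) ≤ q ^ 2 * r := by
        calc q * (1 / 2) ≤ q * (r * q) := by gcongr; linarith
          _ = q ^ 2 * r := by ring
      push_cast
      gcongr
      linarith
    have e3 : G * m ≤ 2 * q * m := by gcongr
    have e4 : η ≤ q * m := by
      rw [hη]
      have : q * ε ≤ q * 1 := by gcongr; linarith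
      have := mul_le_mul_of_nonneg_right this (by linarith : (0 : ℝ) ≤ m)
      linarith
    have e5 : 0 < G * (ε * m) := by positivity
    linarith
  -- the elements up to `40 * m`
  have hnear : bernP q (Icc 1 (40 * m)) (fun S => m - s ≤ #(missing (Icc 1 (40 * m)) S)) ≤
      B / 4 + B / 4 := by
    have hL1 : ((m / 2 : ℕ) : ℝ) ≤ m / 2 := Nat.cast_div_le
    have hL2 : (m : ℝ) / 2 - 1 / 2 ≤ ((m / 2 : ℕ) : ℝ) := by
      have : (m : ℝ) ≤ 2 * ((m / 2 : ℕ) : ℝ) + 1 := by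
        exact_mod_cast (by omega : m ≤ 2 * (m / 2) + 1)
      linarith
    have hqx : q * x * ((m / 2 : ℕ) : ℝ) ≤ η / 2048 := by
      have : q * x * ((m / 2 : ℕ) : ℝ) ≤ q * x * (m / 2) := by gcongr
      linarith
    refine (bernP_card_missing_Icc_le hq0.le hq2 (by omega : m / 2 ≤ 40 * m)
      (by exact_mod_cast hk0 : 0 < k) hd0.le hl0.le hx0 hx1).trans (add_le_add ?_ ?_)
    · rw [← Real.rpow_natCast (1 - q), hrpow]
      refine (mul_le_mul_of_nonneg_left hxk (by positivity)).trans ?_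
      rw [← Real.exp_add, ← Real.exp_add]
      refine hpart _ ?_
      have e1 := mul_le_mul_of_nonneg_left hL2 hG0.le
      linarith
    · rw [hrpow, hld]
      refine (mul_le_mul_of_nonneg_right (mul_le_mul_of_nonneg_left hxk (Real.exp_pos _).le)
        (by positivity)).trans ?_
      rw [← Real.exp_add, ← Real.exp_add, ← Real.exp_add]
      refine hpart _ ?_
      have e1 : 2 * q * (ε / 2560) * ((40 * m : ℕ) : ℝ) = η / 32 := by
        rw [hη]; push_cast; ring
      have e2 : d * ((40 * m : ℕ) : ℝ) / k = ε * m / 8 := by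
        rw [hd]; push_cast; field_simp; norm_num
      have e3 : (m : ℝ) - s ≤ ((m - s : ℕ) : ℝ) := by
        rw [sub_le_iff_le_add]
        exact_mod_cast (by omega : m ≤ m - s + s)
      -- The losses are `ε m / 4` from `s`, `ε m / 8` from double counting and `ε m / 1000` from
      -- `k`, leaving room for the other errors.
      have e4 : (m : ℝ) / 2 - 0.4 * (ε * m) - 1 ≤
          ((m - s : ℕ) : ℝ) - ((m / 2 : ℕ) : ℝ) - k - d * ((40 * m : ℕ) : ℝ) / k := by
        rw [e2]
        have : 0 < ε * m := by positivity
        linarith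
      have e5 := mul_le_mul_of_nonneg_left e4 hG0.le
      rw [e1]
      linarith
  -- Three contributions of `B / 4` leave the strict inequality.
  have hle : missingProb p m ≤ 3 * (B / 4) := by
    refine missingProb_le_of_forall p m (40 * m) _ fun M hM => ?_
    rw [← hq]
    have hsub : Icc 1 (40 * m) ⊆ Icc 1 M := Icc_subset_Icc le_rfl hM
    have e1 : bernP q (Icc 1 M) (fun S => m ≤ #(missing (Icc 1 M) S)) ≤
        bernP q (Icc 1 M) (fun S => s ≤ #(missing (Ioc (40 * m) M) S) ∨
          m - s ≤ #(missing (Icc 1 (40 * m)) S)) := by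
      refine bernP_mono hq0.le (by linarith) fun S _ hS => ?_
      have e2 : missing (Icc 1 M) S ⊆
          missing (Ioc (40 * m) M) S ∪ missing (Icc 1 (40 * m)) S := by
        intro n hn
        rw [mem_missing, mem_Icc] at hn
        rw [mem_union, mem_missing, mem_missing, mem_Ioc, mem_Icc]
        by_cases h : n ≤ 40 * m
        · exact Or.inr ⟨⟨hn.1.1, h⟩, hn.2⟩
        · exact Or.inl ⟨⟨by omega, hn.1.2⟩, hn.2⟩
      have e3 := (card_le_card e2).trans (card_union_le _ _)
      by_contra hcon
      push Not at hcon
      omega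
    have e2 : bernP q (Icc 1 M) (fun S => m - s ≤ #(missing (Icc 1 (40 * m)) S)) =
        bernP q (Icc 1 (40 * m)) (fun S => m - s ≤ #(missing (Icc 1 (40 * m)) S)) := by
      refine bernP_restrict hsub fun S hS => ?_
      have : missing (Icc 1 (40 * m)) S = missing (Icc 1 (40 * m)) (S ∩ Icc 1 (40 * m)) := by
        ext n
        rw [mem_missing, mem_missing, mem_Icc]
        refine and_congr_right fun hn => ⟨fun h a ha b hb =>
          h a (mem_inter.1 ha).1 b (mem_inter.1 hb).1, fun h a ha b hb hab => ?_⟩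
        have ha1 := mem_Icc.1 (hS ha)
        have hb1 := mem_Icc.1 (hS hb)
        exact h a (mem_inter.2 ⟨ha, mem_Icc.2 (by omega)⟩) b
          (mem_inter.2 ⟨hb, mem_Icc.2 (by omega)⟩) hab
      rw [← this]
    refine e1.trans ((bernP_or_le hq0.le (by linarith)).trans ?_)
    rw [e2]
    linarith [hfar M hM]
  rw [← hq, hrpow, ← hB]
  linarith

end UpperBound

theorem theorem1 :
    -- the upper bound
    (∃ C : ℝ, 1 < C ∧ ∀ (m : ℕ) (ε : ℝ) (p : I), 1 ≤ m → 0 < ε → 0 < (p : ℝ) →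
      C * Real.logb 2 (1 / ε) / √(ε ^ 3 * (m : ℝ)) ≤ (p : ℝ) → (p : ℝ) ≤ 1 / 2 →
      missingProb p m < (1 - (p : ℝ)) ^ ((m : ℝ) / 2 - ε * (m : ℝ))) ∧
    -- `1 / √m` is a threshold
    (∀ p : ℕ → I,
      (Tendsto (fun m : ℕ => (p m : ℝ) * √(m : ℝ)) atTop (𝓝 0) →
        Tendsto (fun m : ℕ => missingProb (p m) m) atTop (𝓝 1)) ∧
      (Tendsto (fun m : ℕ => (p m : ℝ) * √(m : ℝ)) atTop atTop →
        Tendsto (fun m : ℕ => missingProb (p m) m) atTop (𝓝 0))) ∧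
    -- the range of `p` is sharp up to the constant: the bound fails below the threshold
    (∃ c : ℝ, 0 < c ∧ ∀ ε : ℝ, 0 < ε → ε < 1 / 2 → ∃ m₀ : ℕ, ∀ (m : ℕ) (p : I), m₀ ≤ m →
      0 < (p : ℝ) → (p : ℝ) ≤ c / √(m : ℝ) →
      (1 - (p : ℝ)) ^ ((m : ℝ) / 2 - ε * (m : ℝ)) < missingProb p m) ∧
    -- the probability is sharp up to the term `ε m` in the exponent
    (∀ (m : ℕ) (p : I), (1 - (p : ℝ)) ^ ((m : ℝ) / 2) ≤ missingProb p m) := by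
  refine ⟨⟨10 ^ 5, by norm_num, fun m ε p hm hε hp hC hp2 => ?_⟩,
    fun p => ⟨tendsto_missingProb_one, tendsto_missingProb_zero⟩,
    ⟨1 / (4 * Real.exp 1), by positivity, fun ε hε hε2 => exists_lt_missingProb hε hε2⟩,
    fun m p => rpow_half_le_missingProb p m⟩
  rcases le_or_gt ε (1 / 2) with hε2 | hε2
  · exact missingProb_lt hm hε hε2 hp hp2 hC
  -- For `ε > 1/2` the exponent is negative, so the right side exceeds `1`.
  · have hm0 : (0 : ℝ) < m := by exact_mod_cast hm
    refine (missingProb_le_one p m).trans_lt ?_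
    exact Real.one_lt_rpow_of_pos_of_lt_one_of_neg (by linarith) (by linarith) (by nlinarith)
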